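/- Consider $n$ servers that run the $(6,3)$-median rule in synchronous rounds. Every server initially stores an arbitrary value from a totally ordered set $K$. In each round an adversary first chooses an arbitrary set of blocked servers (there is no bound on its size); a server is called useful in a round if it stores a value (that is, not $\bot$) at the beginning of the round and is not blocked in that round. Every server sends $6$ requests to servers chosen independently and uniformly at random (with repetition, among all $n$ servers). Each request of a non-blocked server that reaches a useful server is answered with that server's value; all other requests remain unanswered. A server that receives at least $3$ replies picks $3$ of them uniformly at random and stores the median of their values; every other server stores $\bot$. The adversary is $1$-late: its choice in round $t$ depends only on the initial values, on the random choices that the servers made in rounds up to $t-2$, and hence on the states of all servers up to the beginning of round $t-1$. For every constant $c>0$ there are constants $C>0$ and $n_0$, depending only on $c$, such that for all $n\ge n_0$, all totally ordered sets $K$, all initial values and every $1$-late adversary, the following holds with probability at least $1-n^{-c}$, where $T=\lceil C\ln n\rceil$: (1) (Agreement) there is a value $v\in K$ such that, in every round after the first $T$ rounds, all useful servers (if any) hold $v$; and (2) either at least $n/4$ servers are useful in each of the first $T$ rounds, or after $2T$ rounds all servers hold $\bot$ forever. -/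

import Mathlib

open MeasureTheory

universe u

namespace MedianRule

/-- The random choices of one server in one round of the `(k, ℓ)`-median rule with `n` servers:
the `k` servers it sends its value requests to and, for every set `M` of at least `ℓ` requests,
the `ℓ`-subset of `M` that it uses when `M` is exactly the set of requests that get a reply.
Under the uniform distribution the `k` targets are independent and uniform among all `n` servers
and, given the set `M` of answered requests, the chosen `ℓ`-subset of `M` is uniform. -/
def Draw (k ℓ n : ℕ) : Type :=
  (Fin k → Fin n) ×
    ((M : {M : Finset (Fin k) // ℓ ≤ M.card}) → {S : Finset (Fin k) // S ∈ M.1.powersetCard ℓ})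

/-- The servers that receive the requests. -/
def Draw.target {k ℓ n : ℕ} (d : Draw k ℓ n) : Fin k → Fin n := d.1

/-- The chosen `ℓ`-subset of the set `M` of answered requests. -/
def Draw.choice {k ℓ n : ℕ} (d : Draw k ℓ n) (M : Finset (Fin k)) (h : ℓ ≤ M.card) :
    Finset (Fin k) := (d.2 ⟨M, h⟩).1

instance (k ℓ n : ℕ) : Fintype (Draw k ℓ n) :=
  inferInstanceAs (Fintype ((Fin k → Fin n) ×
    ((M : {M : Finset (Fin k) // ℓ ≤ M.card}) → {S : Finset (Fin k) // S ∈ M.1.powersetCard ℓ})))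

instance (k ℓ n : ℕ) [NeZero n] : Nonempty (Draw k ℓ n) :=
  ⟨(fun _ => 0, fun M =>
    ⟨(Finset.powersetCard_nonempty.2 M.2).choose, (Finset.powersetCard_nonempty.2 M.2).choose_spec⟩)⟩

instance (k ℓ n : ℕ) : MeasurableSpace (Draw k ℓ n) := ⊤

/-- The random choices of all servers in all rounds; the first round has number `0`. -/
abbrev Draws (k ℓ n : ℕ) : Type := ℕ → Fin n → Draw k ℓ n

/-- All servers make uniform choices in all rounds, independently of each other. -/
noncomputable def drawMeasure (k ℓ n : ℕ) [NeZero n] : Measure (Draws k ℓ n) :=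
  Measure.infinitePi fun _ : ℕ =>
    Measure.pi fun _ : Fin n => (PMF.uniformOfFintype (Draw k ℓ n)).toMeasure

/-- The values held by the servers; `none` is the undecided state `⊥`. -/
abbrev Config (n : ℕ) (K : Type*) : Type _ := Fin n → Option K

/-- The median of a multiset of odd size (`none` for the empty multiset). -/
def median {K : Type*} [LinearOrder K] (s : Multiset K) : Option K :=
  (s.sort (· ≤ ·))[s.card / 2]?

/-- The servers that store a value and are not blocked, where `B` is the set of blocked servers. -/
def useful {n : ℕ} {K : Type*} (B : Finset (Fin n)) (x : Config n K) : Finset (Fin n) :=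
  Finset.univ.filter fun i => i ∉ B ∧ (x i).isSome

/-- The requests of server `i` that get a reply. A blocked server gets no reply, and only
non-blocked servers that store a value reply. -/
def answered {k ℓ n : ℕ} {K : Type*} (B : Finset (Fin n)) (x : Config n K) (i : Fin n)
    (d : Draw k ℓ n) : Finset (Fin k) :=
  Finset.univ.filter fun r => i ∉ B ∧ d.target r ∈ useful B x

/-- One round of the `(k, ℓ)`-median rule: a server with at least `ℓ` replies adopts the median of
the values in the chosen `ℓ` replies, every other server adopts `⊥`. -/
def step {k ℓ n : ℕ} {K : Type*} [LinearOrder K] (B : Finset (Fin n)) (x : Config n K)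
    (ρ : Fin n → Draw k ℓ n) : Config n K := fun i =>
  if h : ℓ ≤ (answered B x i (ρ i)).card then
    median (((ρ i).choice (answered B x i (ρ i)) h).val.filterMap fun r => x ((ρ i).target r))
  else none

/-- A blocking strategy: `A t ω` is the set of servers blocked in round `t`. -/
abbrev Adversary (k ℓ n : ℕ) : Type := ℕ → Draws k ℓ n → Finset (Fin n)

/-- The adversary is `α`-late: its decision in round `t` depends only on what is determined at the
beginning of round `t - α`, that is, on the random choices made in rounds `s < t - α` (the initial
values are fixed, and these choices determine all states up to the beginning of round `t - α`).
An adversary with random choices of its own is a mixture of such strategies. -/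
def Adversary.IsLate {k ℓ n : ℕ} (α : ℕ) (A : Adversary k ℓ n) : Prop :=
  ∀ (t : ℕ) (ω ω' : Draws k ℓ n), (∀ s, s + α < t → ω s = ω' s) → A t ω = A t ω'

/-- The values at the beginning of round `t`, that is, after `t` rounds of the `(k, ℓ)`-median rule
with initial values `x₀` and adversary `A`. -/
def config {k ℓ n : ℕ} {K : Type*} [LinearOrder K] (A : Adversary k ℓ n) (x₀ : Fin n → K)
    (ω : Draws k ℓ n) : ℕ → Config n K
  | 0 => fun i => some (x₀ i)
  | t + 1 => step (A t ω) (config A x₀ ω t) (ω t)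

/-- The servers that are useful in round `t`. -/
def usefulAt {k ℓ n : ℕ} {K : Type*} [LinearOrder K] (A : Adversary k ℓ n) (x₀ : Fin n → K)
    (ω : Draws k ℓ n) (t : ℕ) : Finset (Fin n) :=
  useful (A t ω) (config A x₀ ω t)

/-- Agreement within `T` rounds: after `T` rounds, all useful servers hold the same value, for ever.
(This includes the case that there is no useful server any more.) -/
def AgreementAfter {k ℓ n : ℕ} {K : Type*} [LinearOrder K] (A : Adversary k ℓ n) (x₀ : Fin n → K)
    (ω : Draws k ℓ n) (T : ℕ) : Prop :=
  ∃ v : K, ∀ t, T ≤ t → ∀ i ∈ usefulAt A x₀ ω t, config A x₀ ω t i = some v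

/-- At least `n / 4` servers are useful in each of the first `T` rounds. -/
def QuarterUseful {k ℓ n : ℕ} {K : Type*} [LinearOrder K] (A : Adversary k ℓ n) (x₀ : Fin n → K)
    (ω : Draws k ℓ n) (T : ℕ) : Prop :=
  ∀ t < T, (n : ℝ) / 4 ≤ (usefulAt A x₀ ω t).card

/-- After `T` rounds, all servers hold `⊥`, for ever. -/
def AllUndecidedAfter {k ℓ n : ℕ} {K : Type*} [LinearOrder K] (A : Adversary k ℓ n)
    (x₀ : Fin n → K) (ω : Draws k ℓ n) (T : ℕ) : Prop :=
  ∀ t, T ≤ t → ∀ i, config A x₀ ω t i = none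

end MedianRule

/-!
The proof is a drift argument for a potential function, made possible by lateness. Fix the draws of
all rounds before round `t`. They determine the values in round `t` and, the adversary being 1-late,
also the sets of servers blocked in the rounds `t` and `t + 1`. Every server outside these two sets
is therefore useful in round `t + 1` independently of the others with some probability `p`
(`replyProb`), and if it is useful, its value is the median of three uniform samples of the values
of the servers that are useful in round `t`. The adversary only controls how many servers take part.

*Agreement.* For a threshold `v`, let `q` be the fraction of the useful servers with a value of at
most `v`. Given the number `k` of useful servers in the next round, the number of those below the
threshold is binomial with parameters `k` and `3 q ^ 2 - 2 q ^ 3` (`average_step`). The potential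
`q (1 - q) / (Λ + (q - 1 / 2) ^ 2)` with `Λ = 160 / n` decreases by a constant factor in expectation
if `k ≥ n / 4` (`binomialMean_potential_le`). Away from `q = 1 / 2` this is due to the map
`q ↦ 3 q ^ 2 - 2 q ^ 3`, which amplifies the imbalance. Near the unstable equilibrium `q = 1 / 2` it
is due to the variance of the binomial distribution, on whose scale the potential is concave in
`(q - 1 / 2)`; only its moments up to order four are used, and no anti-concentration. The potential
lies between `1 / n` and `n` as long as the threshold separates useful servers, so Markov's
inequality leaves a probability of at most `n ^ 2 (1 - ε) ^ t` for this after `t` rounds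
(`measure_not_agree_le`). A union bound over the at most `n` initial values as thresholds gives
agreement.

*Extinction.* If less than a quarter of the servers is useful, then the expected number of useful
servers decreases by the factor `7 / 10` per round (`replyProb_le`), because the probability of
three replies is of third order in the fraction of useful servers. Hence no useful server is left after
logarithmically many rounds (`measure_not_extinct_le`), unless a quarter is reached again, which has
an exponentially small probability (`measure_recovery_le`).

The passage from the mean over one round to the mean over all draws is `lintegral_le_of_average_le`:
resampling one coordinate preserves the product measure.
-/

namespace MedianRule

/-! ### Means of binomial random variables -/

/-- The mean of `f X` for a binomial random variable `X` with `k` trials of success probability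
`g`, by recursion on the number of trials. -/
def binomialMean (g : ℝ) : ℕ → (ℕ → ℝ) → ℝ
  | 0, f => f 0
  | k + 1, f => (1 - g) * binomialMean g k f + g * binomialMean g k fun j => f (j + 1)

theorem binomialMean_add (g : ℝ) (k : ℕ) (f₁ f₂ : ℕ → ℝ) :
    binomialMean g k (fun j => f₁ j + f₂ j) = binomialMean g k f₁ + binomialMean g k f₂ := by
  induction k generalizing f₁ f₂ with
  | zero => rfl
  | succ k ih =>
    simp only [binomialMean, ih f₁ f₂, ih (fun j => f₁ (j + 1)) (fun j => f₂ (j + 1))]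
    ring

theorem binomialMean_const_mul (g : ℝ) (k : ℕ) (a : ℝ) (f : ℕ → ℝ) :
    binomialMean g k (fun j => a * f j) = a * binomialMean g k f := by
  induction k generalizing f with
  | zero => rfl
  | succ k ih =>
    simp only [binomialMean, ih f, ih (fun j => f (j + 1))]
    ring

theorem binomialMean_const (g : ℝ) (k : ℕ) (a : ℝ) : binomialMean g k (fun _ => a) = a := by
  induction k with
  | zero => rfl
  | succ k ih => simp only [binomialMean, ih]; ring

theorem binomialMean_mono {g : ℝ} (h0 : 0 ≤ g) (h1 : g ≤ 1) (k : ℕ) {f₁ f₂ : ℕ → ℝ}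
    (h : ∀ j ≤ k, f₁ j ≤ f₂ j) : binomialMean g k f₁ ≤ binomialMean g k f₂ := by
  induction k generalizing f₁ f₂ with
  | zero => exact h 0 le_rfl
  | succ k ih =>
    have a := ih (f₁ := f₁) (f₂ := f₂) fun j hj => h j (by omega)
    have b := ih (f₁ := fun j => f₁ (j + 1)) (f₂ := fun j => f₂ (j + 1))
      fun j hj => h (j + 1) (by omega)
    simp only [binomialMean]
    have := sub_nonneg.2 h1
    gcongr

theorem binomialMean_id_sub (g : ℝ) (k : ℕ) (c : ℝ) :
    binomialMean g k (fun j => (j : ℝ) - c) = k * g - c := by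
  induction k generalizing c with
  | zero => simp [binomialMean]
  | succ k ih =>
    have e : (fun j : ℕ => ((j + 1 : ℕ) : ℝ) - c) = fun j : ℕ => (j : ℝ) - (c - 1) := by
      ext j; push_cast; ring
    simp only [binomialMean, e, ih]
    push_cast; ring

theorem binomialMean_sub_sq (g : ℝ) (k : ℕ) (c : ℝ) :
    binomialMean g k (fun j => ((j : ℝ) - c) ^ 2) = k * (g * (1 - g)) + (k * g - c) ^ 2 := by
  induction k generalizing c with
  | zero => simp [binomialMean]
  | succ k ih =>
    have e : (fun j : ℕ => (((j + 1 : ℕ) : ℝ) - c) ^ 2) = fun j : ℕ => ((j : ℝ) - (c - 1)) ^ 2 := by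
      ext j; push_cast; ring
    simp only [binomialMean, e, ih]
    push_cast; ring

theorem binomialMean_sub_pow_four (g : ℝ) (k : ℕ) (c : ℝ) :
    binomialMean g k (fun j => ((j : ℝ) - c) ^ 4) =
      k * (g * (1 - g)) * (1 - 3 * (g * (1 - g))) + 3 * k * (k - 1) * (g * (1 - g)) ^ 2
        + 4 * (k * (g * (1 - g)) * (1 - 2 * g)) * (k * g - c)
        + 6 * (k * (g * (1 - g))) * (k * g - c) ^ 2 + (k * g - c) ^ 4 := by
  induction k generalizing c with
  | zero => simp [binomialMean]
  | succ k ih =>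
    have e : (fun j : ℕ => (((j + 1 : ℕ) : ℝ) - c) ^ 4) = fun j : ℕ => ((j : ℝ) - (c - 1)) ^ 4 := by
      ext j; push_cast; ring
    simp only [binomialMean, e, ih]
    push_cast; ring

theorem binomialMean_pow (g : ℝ) (k : ℕ) (a : ℝ) :
    binomialMean g k (fun j => a ^ j) = (1 - g + g * a) ^ k := by
  induction k with
  | zero => simp [binomialMean]
  | succ k ih =>
    have e : (fun j : ℕ => a ^ (j + 1)) = fun j : ℕ => a * a ^ j := by
      ext j; ring
    simp only [binomialMean, e, binomialMean_const_mul, ih]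
    ring

/-- The binomial mean as a sum over the sets of successful trials. -/
theorem sum_powerset_eq_binomialMean {ι : Type*} [DecidableEq ι] (g : ℝ) (D : Finset ι)
    (f : ℕ → ℝ) :
    ∑ O ∈ D.powerset, g ^ O.card * (1 - g) ^ (D.card - O.card) * f O.card
      = binomialMean g D.card f := by
  induction D using Finset.induction_on generalizing f with
  | empty => simp [binomialMean]
  | insert i D hi ih =>
    rw [Finset.sum_powerset_insert hi, Finset.card_insert_of_notMem hi, binomialMean, ← ih, ← ih,
      Finset.mul_sum, Finset.mul_sum]
    congr 1
    · refine Finset.sum_congr rfl fun O hO => ?_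
      have := Finset.card_le_card (Finset.mem_powerset.1 hO)
      rw [Nat.succ_sub this, pow_succ]
      ring
    · refine Finset.sum_congr rfl fun O hO => ?_
      have : i ∉ O := fun h => hi (Finset.mem_powerset.1 hO h)
      rw [Finset.card_insert_of_notMem this, Nat.add_sub_add_right]
      ring

/-! ### The potential of a fraction of low values -/

/-- The potential of a fraction `q` of low values: it is large, of order `1 / Λ`, at the unstable
equilibrium `q = 1 / 2`, of constant order away from it, and vanishes exactly at agreement. -/
noncomputable def potential (Λ q : ℝ) : ℝ := q * (1 - q) / (Λ + (q - 1 / 2) ^ 2)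

theorem potential_nonneg {Λ q : ℝ} (hΛ : 0 ≤ Λ) (h0 : 0 ≤ q) (h1 : q ≤ 1) : 0 ≤ potential Λ q :=
  div_nonneg (mul_nonneg h0 (sub_nonneg.2 h1)) (by positivity)

/-- Second-order expansion of the potential in `w = q (1 - q)` around `m`, with a remainder that
is controlled by the minimal denominator `Λ`. -/
theorem potential_le {Λ q m : ℝ} (hΛ : 0 < Λ) (hm : m < Λ + 1 / 4) :
    potential Λ q ≤ m / (Λ + 1 / 4 - m)
      + (Λ + 1 / 4) / (Λ + 1 / 4 - m) ^ 2 * (q * (1 - q) - m)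
      + (Λ + 1 / 4) / ((Λ + 1 / 4 - m) ^ 2 * Λ) * (q * (1 - q) - m) ^ 2 := by
  set D := Λ + 1 / 4 - m with hD
  set z := q * (1 - q) - m with hz
  have hDpos : 0 < D := by linarith
  have e : Λ + (q - 1 / 2) ^ 2 = D - z := by rw [hD, hz]; ring
  have hle : Λ ≤ D - z := by rw [← e]; nlinarith [sq_nonneg (q - 1 / 2)]
  have hpos : 0 < D - z := hΛ.trans_le hle
  have e2 : potential Λ q = m / D + (Λ + 1 / 4) / D ^ 2 * z
      + (Λ + 1 / 4) / (D ^ 2 * (D - z)) * z ^ 2 := by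
    have h1 : q * (1 - q) = m + z := by rw [hz]; ring
    have h2 : Λ + 1 / 4 = D + m := by rw [hD]; ring
    rw [potential, e, h1, h2]
    field_simp
    ring
  rw [e2]
  gcongr

/-- The expected decrease of the potential, after all moments have been computed. Here
`w = q (1 - q)`, `d = (q - 1 / 2) ^ 2`, and `e` is the variance of the new fraction. -/
theorem drift_inequality {Λ w d e ε : ℝ} (hΛ : 0 < Λ) (hw : 0 ≤ w) (hd : 0 ≤ d)
    (hwd : w + d = 1 / 4) (he : Λ * (w ^ 2 * (3 + 4 * w)) ≤ 160 * e) (hε : ε = 1 / 20000) :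
    (w * (3 + 4 * w)) * (Λ + d) *
      ((Λ + d * (1 + 2 * w) ^ 2 + e) + 1 / 10 * (d * (1 + 2 * w) ^ 2 + e))
      ≤ (1 - ε) * (Λ + d * (1 + 2 * w) ^ 2 + e) ^ 2 := by
  have he0 : 0 ≤ e := by
    have : 0 ≤ Λ * (w ^ 2 * (3 + 4 * w)) := by positivity
    linarith
  set d' := d * (1 + 2 * w) ^ 2 with hd'
  have hd'd : d' = d + 4 * w * (1 + w) * d := by rw [hd']; ring
  have hd'0 : 0 ≤ d' := by positivity
  have hfac : w * (3 + 4 * w) ≤ 1 - 4 * d := by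
    have : w = 1 / 4 - d := by linarith
    subst this
    nlinarith
  have hwm : 0 ≤ w * (1 + w) * d := by positivity
  set D := Λ + d' + e with hD
  have hDpos : 0 < D := by positivity
  have hbr : 0 ≤ D + 1 / 10 * (d' + e) := by positivity
  have hΛd : 0 ≤ Λ + d := by positivity
  rcases le_total (1 / 8) w with h8 | h8
  · -- near the equilibrium, the growth of the imbalance and the noise both decrease the potential
    have h1 : w * (3 + 4 * w) ≤ 1 := by linarith
    have h2 : Λ + d ≤ D - d / 2 - e := by
      rw [hD, hd'd]
      have : 1 / 8 * d ≤ w * d := by gcongr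
      nlinarith [mul_nonneg (mul_nonneg hw hw) hd]
    have h3 : d' ≤ 9 / 4 * d := by
      have : (1 + 2 * w) ^ 2 ≤ 9 / 4 := by nlinarith
      rw [hd']; nlinarith
    have h4 : Λ * (3 / 64) ≤ 160 * e := by
      refine le_trans ?_ he
      have : 3 / 64 ≤ w ^ 2 * (3 + 4 * w) := by nlinarith
      gcongr
    calc w * (3 + 4 * w) * (Λ + d) * (D + 1 / 10 * (d' + e))
        ≤ 1 * (D - d / 2 - e) * (D + 1 / 10 * (9 / 4 * d + e)) := by
          have h5 : 0 ≤ 1 * (D - d / 2 - e) := by linarith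
          gcongr
      _ ≤ D * (D - (d / 4 + e / 2)) := by
        nlinarith [mul_nonneg hd hDpos.le, mul_nonneg he0 hDpos.le, mul_nonneg hd hd,
          mul_nonneg hd he0, mul_nonneg he0 he0]
      _ ≤ D * (D - ε * D) := by
        gcongr
        rw [hε, hD]
        linarith
      _ = (1 - ε) * D ^ 2 := by ring
  · -- away from it, the minority fraction shrinks by a constant factor
    have h1 : w * (3 + 4 * w) ≤ 1 / 2 := by nlinarith
    have h2 : Λ + d ≤ D := by rw [hD, hd'd]; linarith
    calc w * (3 + 4 * w) * (Λ + d) * (D + 1 / 10 * (d' + e))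
        ≤ 1 / 2 * D * (D + 1 / 10 * D) := by
          have : d' + e ≤ D := by rw [hD]; linarith
          gcongr
      _ ≤ (1 - ε) * D ^ 2 := by rw [hε]; nlinarith [sq_nonneg D]

/-- The mean of `X / k * (1 - X / k)` for a binomial random variable `X`. -/
theorem binomialMean_mul_one_sub (g : ℝ) {k : ℕ} (hk : (0 : ℝ) < k) :
    binomialMean g k (fun j => (j / k : ℝ) * (1 - j / k) - (g * (1 - g) - g * (1 - g) / k))
      = 0 := by
  have : (fun j : ℕ => (j / k : ℝ) * (1 - j / k) - (g * (1 - g) - g * (1 - g) / k)) =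
      fun j : ℕ => (g * (1 - g) / k + (1 - 2 * g) / k * ((j : ℝ) - k * g))
        + (-1 / k ^ 2) * ((j : ℝ) - k * g) ^ 2 := by
    ext j
    field_simp
    ring
  rw [this, binomialMean_add, binomialMean_add, binomialMean_const, binomialMean_const_mul,
    binomialMean_const_mul, binomialMean_id_sub, binomialMean_sub_sq]
  field_simp
  ring

/-- A bound on the variance of `X / k * (1 - X / k)` for a binomial random variable `X`. -/
theorem binomialMean_mul_one_sub_sq_le {g : ℝ} (hg0 : 0 ≤ g) (hg1 : g ≤ 1) {k : ℕ}
    (hk : (0 : ℝ) < k) :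
    binomialMean g k
        (fun j => ((j / k : ℝ) * (1 - j / k) - (g * (1 - g) - g * (1 - g) / k)) ^ 2)
      ≤ g * (1 - g) / k * (8 * (1 / 4 - g * (1 - g)) + 2 / k ^ 2 + 6 * (g * (1 - g) / k)) := by
  obtain ⟨e, he⟩ : ∃ e : ℝ, e = g * (1 - g) / k := ⟨_, rfl⟩
  have hw : g * (1 - g) = e * k := by rw [he]; field_simp
  have hzsq : ∀ j : ℕ, ((j / k : ℝ) * (1 - j / k) - (g * (1 - g) - g * (1 - g) / k)) ^ 2
      ≤ (2 * (1 - 2 * g) ^ 2 / k ^ 2) * ((j : ℝ) - k * g) ^ 2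
      + ((2 / k ^ 4) * ((j : ℝ) - k * g) ^ 4 + (-(4 * e) / k ^ 2) * ((j : ℝ) - k * g) ^ 2
        + 2 * e ^ 2) := by
    intro j
    rw [← he]
    obtain ⟨y, hy⟩ : ∃ y : ℝ, y = ((j : ℝ) - k * g) / k := ⟨_, rfl⟩
    have hy' : (j : ℝ) - k * g = y * k := by rw [hy]; field_simp
    have hj : (j : ℝ) / k = y + g := by rw [hy]; field_simp; ring
    have r3 : 2 * (1 - 2 * g) ^ 2 / (k : ℝ) ^ 2 * (y * k) ^ 2 = 2 * ((1 - 2 * g) * y) ^ 2 := by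
      field_simp
    have r4 : 2 / (k : ℝ) ^ 4 * (y * k) ^ 4 = 2 * y ^ 4 := by field_simp
    have r5 : -(4 * e) / (k : ℝ) ^ 2 * (y * k) ^ 2 = -(4 * e) * y ^ 2 := by field_simp
    have r6 : (y + g) * (1 - (y + g)) - (g * (1 - g) - e) = (1 - 2 * g) * y + (e - y ^ 2) := by
      ring
    rw [hj, r6, hy', r3, r4, r5]
    nlinarith [sq_nonneg ((1 - 2 * g) * y - (e - y ^ 2))]
  refine (binomialMean_mono hg0 hg1 k fun j _ => hzsq j).trans ?_
  rw [binomialMean_add, binomialMean_add, binomialMean_add, binomialMean_const,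
    binomialMean_const_mul, binomialMean_const_mul, binomialMean_const_mul,
    binomialMean_sub_sq, binomialMean_sub_pow_four, ← he]
  have h4 : 1 / 4 - g * (1 - g) = (1 - 2 * g) ^ 2 / 4 := by ring
  rw [h4, hw, sub_self]
  have e1 : 2 * (1 - 2 * g) ^ 2 / (k : ℝ) ^ 2 * (k * (e * k) + 0 ^ 2)
      = 2 * (1 - 2 * g) ^ 2 * e := by
    field_simp; ring
  have e2 : 2 / (k : ℝ) ^ 4 * (k * (e * k) * (1 - 3 * (e * k)) + 3 * k * (k - 1) * (e * k) ^ 2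
      + 4 * (k * (e * k) * (1 - 2 * g)) * 0 + 6 * (k * (e * k)) * 0 ^ 2 + 0 ^ 4)
      = 2 * e / k ^ 2 - 12 * e ^ 2 / k + 6 * e ^ 2 := by
    field_simp; ring
  have e3 : -(4 * e) / (k : ℝ) ^ 2 * (k * (e * k) + 0 ^ 2) = -4 * e ^ 2 := by
    field_simp; ring
  rw [e1, e2, e3]
  have : 0 ≤ 12 * e ^ 2 / k := by positivity
  have r : e * (8 * ((1 - 2 * g) ^ 2 / 4) + 2 / (k : ℝ) ^ 2 + 6 * e)
      = 2 * (1 - 2 * g) ^ 2 * e + 2 * e / k ^ 2 + 6 * e ^ 2 := by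
    ring
  rw [r]
  nlinarith [sq_nonneg e]

/-- The contraction of the potential: if `k` servers, a constant fraction of all `n`, independently
adopt the median of three samples of a population with a fraction `q` of low values, then the
potential decreases by a constant factor in expectation. The choice `Λ = 160 / n` is a large
multiple of the order `1 / n` of the variance of the new fraction, which makes the remainder of the
second-order expansion small against the gain from that variance. -/
theorem binomialMean_potential_le {n k : ℕ} (hn : 640 ≤ n) (hkn : k ≤ n) (hnk : n ≤ 4 * k)
    {q : ℝ} (h0 : 0 ≤ q) (h1 : q ≤ 1) :
    binomialMean (3 * q ^ 2 - 2 * q ^ 3) k (fun j => potential (160 / n) (j / k))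
      ≤ (1 - 1 / 20000) * potential (160 / n) q := by
  set g := 3 * q ^ 2 - 2 * q ^ 3 with hg
  have hg0 : 0 ≤ g := by
    have : g = q ^ 2 * (1 + 2 * (1 - q)) := by rw [hg]; ring
    rw [this]
    have := sub_nonneg.2 h1
    positivity
  have hg1 : g ≤ 1 := by
    have : 1 - g = (1 - q) ^ 2 * (1 + 2 * q) := by rw [hg]; ring
    have h : 0 ≤ 1 - g := by rw [this]; positivity
    linarith
  have hk : (1 : ℝ) ≤ k := by
    have : 1 ≤ k := by omega
    exact_mod_cast this
  have hnR : (640 : ℝ) ≤ n := by exact_mod_cast hn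
  have hknR : (k : ℝ) ≤ n := by exact_mod_cast hkn
  have hnkR : (n : ℝ) ≤ 4 * k := by exact_mod_cast hnk
  have hn0 : (0 : ℝ) < n := by linarith
  have hk0 : (0 : ℝ) < k := by linarith
  obtain ⟨Λ, hΛ⟩ : ∃ Λ : ℝ, Λ = 160 / n := ⟨_, rfl⟩
  rw [← hΛ]
  have hΛ0 : 0 < Λ := by rw [hΛ]; positivity
  have hΛ1 : Λ ≤ 1 / 4 := by rw [hΛ, div_le_iff₀ hn0]; linarith
  have hΛk : 40 ≤ Λ * k := by
    rw [hΛ, div_mul_eq_mul_div, le_div_iff₀ hn0]; linarith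
  have hΛk' : Λ * k ≤ 160 := by
    rw [hΛ, div_mul_eq_mul_div, div_le_iff₀ hn0]; linarith
  obtain ⟨w, hw⟩ : ∃ w : ℝ, w = q * (1 - q) := ⟨_, rfl⟩
  obtain ⟨d, hd⟩ : ∃ d : ℝ, d = (q - 1 / 2) ^ 2 := ⟨_, rfl⟩
  have hw0 : 0 ≤ w := by rw [hw]; exact mul_nonneg h0 (sub_nonneg.2 h1)
  have hd0 : 0 ≤ d := by rw [hd]; positivity
  have hwd : w + d = 1 / 4 := by rw [hw, hd]; ring
  obtain ⟨w', hw'⟩ : ∃ w' : ℝ, w' = g * (1 - g) := ⟨_, rfl⟩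
  have hw'w : w' = w ^ 2 * (3 + 4 * w) := by rw [hw', hg, hw]; ring
  have hw'0 : 0 ≤ w' := by rw [hw'w]; positivity
  have hd' : 1 / 4 - w' = d * (1 + 2 * w) ^ 2 := by rw [hw'w, ← hwd]; rw [hw, hd]; ring
  obtain ⟨d', hd'e⟩ : ∃ d' : ℝ, d' = d * (1 + 2 * w) ^ 2 := ⟨_, rfl⟩
  have hd'0 : 0 ≤ d' := by rw [hd'e]; positivity
  rw [← hd'e] at hd'
  obtain ⟨e, he⟩ : ∃ e : ℝ, e = w' / k := ⟨_, rfl⟩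
  have he0 : 0 ≤ e := by rw [he]; positivity
  obtain ⟨m, hm⟩ : ∃ m : ℝ, m = w' - e := ⟨_, rfl⟩
  obtain ⟨D, hD⟩ : ∃ D : ℝ, D = Λ + d' + e := ⟨_, rfl⟩
  have hD0 : 0 < D := by rw [hD]; positivity
  have hDm : Λ + 1 / 4 - m = D := by rw [hm, hD]; linarith
  set z : ℕ → ℝ := fun j => (j / k : ℝ) * (1 - j / k) - m with hz
  have hme : m = g * (1 - g) - g * (1 - g) / k := by rw [hm, he, hw']
  have hEz : binomialMean g k z = 0 := by
    rw [hz, hme]; exact binomialMean_mul_one_sub g hk0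
  have hEzsq : binomialMean g k (fun j => z j ^ 2) ≤ e * (8 * d' + 2 / k ^ 2 + 6 * e) := by
    have := binomialMean_mul_one_sub_sq_le hg0 hg1 hk0
    rw [← hme, ← hw', ← he, hd'] at this
    exact this
  have hmean : binomialMean g k (fun j => potential Λ (j / k)) ≤ m / D
      + (Λ + 1 / 4) / (D ^ 2 * Λ) * (e * (8 * d' + 2 / k ^ 2 + 6 * e)) := by
    have hb : ∀ j ≤ k, potential Λ (j / k) ≤ (m / D + (Λ + 1 / 4) / D ^ 2 * z j)
        + (Λ + 1 / 4) / (D ^ 2 * Λ) * z j ^ 2 := by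
      intro j _
      have := potential_le (q := (j / k : ℝ)) (m := m) hΛ0 (by linarith)
      rw [hDm] at this
      exact this
    refine (binomialMean_mono hg0 hg1 k hb).trans ?_
    rw [binomialMean_add, binomialMean_add, binomialMean_const, binomialMean_const_mul,
      binomialMean_const_mul, hEz, mul_zero, add_zero]
    gcongr
  refine hmean.trans ?_
  have hmain := drift_inequality (ε := 1 / 20000) hΛ0 hw0 hd0 hwd (e := e)
    (by rw [← hw'w, he]
        calc Λ * w' = (Λ * k) * (w' / k) := by field_simp
          _ ≤ 160 * (w' / k) := by gcongr) rfl
  rw [← hd'e, ← hD] at hmain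
  -- compare the bound on the mean with the left side of the drift inequality
  have hle : m / D + (Λ + 1 / 4) / (D ^ 2 * Λ) * (e * (8 * d' + 2 / k ^ 2 + 6 * e))
      ≤ w' * (D + 1 / 10 * (d' + e)) / D ^ 2 := by
    have h2 : m / D + (Λ + 1 / 4) / (D ^ 2 * Λ) * (e * (8 * d' + 2 / k ^ 2 + 6 * e))
        = (m * D + (Λ + 1 / 4) * (e / Λ * (8 * d' + 2 / k ^ 2 + 6 * e))) / D ^ 2 := by
      field_simp
    rw [h2]
    gcongr
    have h3 : e / Λ ≤ w' / 40 := by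
      rw [he, div_div, mul_comm (k : ℝ)]
      gcongr
    have h4 : 2 / (k : ℝ) ^ 2 ≤ D / k * (1 / 20) := by
      have : 40 / (k : ℝ) ≤ D := by
        rw [div_le_iff₀ hk0]
        have : Λ * k ≤ D * k := by gcongr; rw [hD]; linarith
        linarith
      calc 2 / (k : ℝ) ^ 2 = (40 / k) / k * (1 / 20) := by field_simp; norm_num
        _ ≤ D / k * (1 / 20) := by gcongr
    have h5 : m = w' * (1 - 1 / k) := by rw [hm, he]; field_simp
    calc m * D + (Λ + 1 / 4) * (e / Λ * (8 * d' + 2 / k ^ 2 + 6 * e))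
        ≤ m * D + (1 / 2) * (w' / 40 * (8 * d' + D / k * (1 / 20) + 6 * e)) := by
          have : Λ + 1 / 4 ≤ 1 / 2 := by linarith
          gcongr
      _ = w' * (D - D / k + (8 * d' + D / k * (1 / 20) + 6 * e) / 80) := by rw [h5]; ring
      _ ≤ w' * (D + 1 / 10 * (d' + e)) := by
          have : 0 ≤ D / k := by positivity
          refine mul_le_mul_of_nonneg_left ?_ hw'0
          linarith
  refine hle.trans ?_
  rw [div_le_iff₀ (by positivity), potential, ← hd, ← hw]
  have hΛd : 0 < Λ + d := by positivity
  have h6 : (1 - 1 / 20000) * (w / (Λ + d)) * D ^ 2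
      = w * ((1 - 1 / 20000) * D ^ 2) / (Λ + d) := by ring
  rw [h6, le_div_iff₀ hΛd, hw'w]
  nlinarith [mul_le_mul_of_nonneg_left hmain hw0]

/-! ### Counting target vectors -/

/-- The product of a function that is constant on the layers of a chain `P ⊆ S ⊆ M`. -/
theorem prod_ite_chain {ι R : Type*} [Fintype ι] [DecidableEq ι] [CommMonoid R]
    {P S M : Finset ι} (hPS : P ⊆ S) (hSM : S ⊆ M) (a b c d : R) :
    (∏ r, if r ∈ P then a else if r ∈ S then b else if r ∈ M then c else d)
      = a ^ P.card * b ^ (S.card - P.card) * c ^ (M.card - S.card)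
        * d ^ (Fintype.card ι - M.card) := by
  rw [← Finset.prod_sdiff (Finset.subset_univ M), ← Finset.prod_sdiff hSM,
    ← Finset.prod_sdiff hPS]
  have h1 : (∏ r ∈ P, if r ∈ P then a else if r ∈ S then b else if r ∈ M then c else d)
      = a ^ P.card := by
    rw [Finset.prod_congr rfl (g := fun _ => a) fun r hr => by simp [hr], Finset.prod_const]
  have h2 : (∏ r ∈ S \ P, if r ∈ P then a else if r ∈ S then b else if r ∈ M then c else d)
      = b ^ (S.card - P.card) := by
    rw [Finset.prod_congr rfl (g := fun _ => b) fun r hr => by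
      simp [(Finset.mem_sdiff.1 hr).1, (Finset.mem_sdiff.1 hr).2], Finset.prod_const,
      Finset.card_sdiff_of_subset hPS]
  have h3 : (∏ r ∈ M \ S, if r ∈ P then a else if r ∈ S then b else if r ∈ M then c else d)
      = c ^ (M.card - S.card) := by
    rw [Finset.prod_congr rfl (g := fun _ => c) fun r hr => by
      have hrP : r ∉ P := fun h => (Finset.mem_sdiff.1 hr).2 (hPS h)
      simp [(Finset.mem_sdiff.1 hr).1, (Finset.mem_sdiff.1 hr).2, hrP], Finset.prod_const,
      Finset.card_sdiff_of_subset hSM]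
  have h4 : (∏ r ∈ Finset.univ \ M,
      if r ∈ P then a else if r ∈ S then b else if r ∈ M then c else d)
      = d ^ (Fintype.card ι - M.card) := by
    rw [Finset.prod_congr rfl (g := fun _ => d) fun r hr => by
      have hrM : r ∉ M := (Finset.mem_sdiff.1 hr).2
      have hrS : r ∉ S := fun h => hrM (hSM h)
      have hrP : r ∉ P := fun h => hrS (hPS h)
      simp [hrM, hrS, hrP], Finset.prod_const,
      Finset.card_sdiff_of_subset (Finset.subset_univ M), Finset.card_univ]
  rw [h1, h2, h3, h4]
  ac_rfl

/-- The number of target vectors with prescribed answered requests `M` and prescribed requests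
`P` among `S ⊆ M` that reach a server in `O`. -/
theorem card_targets {k n : ℕ} {U O : Finset (Fin n)} (hOU : O ⊆ U) {P S M : Finset (Fin k)}
    (hPS : P ⊆ S) (hSM : S ⊆ M) :
    (Finset.univ.filter fun f : Fin k → Fin n =>
        (Finset.univ.filter fun r => f r ∈ U) = M ∧ (S.filter fun r => f r ∈ O) = P).card
      = O.card ^ P.card * (U.card - O.card) ^ (S.card - P.card) * U.card ^ (M.card - S.card)
        * (n - U.card) ^ (k - M.card) := by
  have h : (Finset.univ.filter fun f : Fin k → Fin n =>
        (Finset.univ.filter fun r => f r ∈ U) = M ∧ (S.filter fun r => f r ∈ O) = P)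
      = Fintype.piFinset fun r => if r ∈ P then O else if r ∈ S then U \ O else
          if r ∈ M then U else Finset.univ \ U := by
    ext f
    simp only [Finset.mem_filter, Finset.mem_univ, true_and, Fintype.mem_piFinset]
    constructor
    · rintro ⟨rfl, rfl⟩ r
      have h0 : f r ∈ O → f r ∈ U := fun h => hOU h
      have h0' : r ∈ S → f r ∈ U := fun h => (Finset.mem_filter.1 (hSM h)).2
      by_cases h1 : f r ∈ O <;> by_cases h2 : r ∈ S <;> by_cases h3 : f r ∈ U <;> simp_all
    · intro h
      refine ⟨Finset.ext fun r => ?_, Finset.ext fun r => ?_⟩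
      · have := h r
        by_cases h1 : r ∈ P
        · have h2 := hPS h1
          have h3 := hSM h2
          simp only [h1, if_true] at this
          simp [h3, hOU this]
        · by_cases h2 : r ∈ S
          · have h3 := hSM h2
            simp only [h1, h2, if_true, if_false, Finset.mem_sdiff] at this
            simp [h3, this.1]
          · by_cases h3 : r ∈ M <;> simpa [h1, h2, h3] using this
      · have := h r
        by_cases h1 : r ∈ P
        · have h2 := hPS h1
          simp only [h1, if_true] at this
          simp [h2, h1, this]
        · by_cases h2 : r ∈ S
          · simp only [h1, h2, if_true, if_false, Finset.mem_sdiff] at this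
            simp [h1, this.2]
          · simp [h1, h2]
  rw [h, Fintype.card_piFinset]
  have e : ∀ r : Fin k, (if r ∈ P then O else if r ∈ S then U \ O else
          if r ∈ M then U else Finset.univ \ U).card
      = if r ∈ P then O.card else if r ∈ S then U.card - O.card else
          if r ∈ M then U.card else n - U.card := by
    intro r
    rw [← Finset.card_sdiff_of_subset hOU]
    have : (Finset.univ \ U).card = n - U.card := by
      rw [Finset.card_sdiff_of_subset (Finset.subset_univ U), Finset.card_univ, Fintype.card_fin]
    rw [← this]
    split_ifs <;> rfl
  simp only [e]
  rw [prod_ite_chain hPS hSM, Fintype.card_fin]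

theorem card_targets_answered {k n : ℕ} (U : Finset (Fin n)) (M : Finset (Fin k)) :
    (Finset.univ.filter fun f : Fin k → Fin n =>
        (Finset.univ.filter fun r => f r ∈ U) = M).card
      = U.card ^ M.card * (n - U.card) ^ (k - M.card) := by
  have := card_targets (Finset.empty_subset U) (Finset.empty_subset (∅ : Finset (Fin k)))
    (Finset.empty_subset M)
  simpa using this

/-- Among the target vectors with answered requests `M`, the fraction of those for which at least
two of three given answered requests reach `O` is `3 q ^ 2 - 2 q ^ 3` with `q = |O| / |U|`. -/
theorem card_targets_majority {k n : ℕ} {U O : Finset (Fin n)} (hOU : O ⊆ U)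
    {S M : Finset (Fin k)} (hSM : S ⊆ M) (hS : S.card = 3) :
    ((Finset.univ.filter fun f : Fin k → Fin n =>
        (Finset.univ.filter fun r => f r ∈ U) = M ∧ 2 ≤ (S.filter fun r => f r ∈ O).card).card : ℝ)
      = (3 * ((O.card : ℝ) / U.card) ^ 2 - 2 * ((O.card : ℝ) / U.card) ^ 3) *
        (Finset.univ.filter fun f : Fin k → Fin n =>
          (Finset.univ.filter fun r => f r ∈ U) = M).card := by
  have hM : 3 ≤ M.card := hS ▸ Finset.card_le_card hSM
  have hle := Finset.card_le_card hOU
  have h1 : (Finset.univ.filter fun f : Fin k → Fin n =>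
        (Finset.univ.filter fun r => f r ∈ U) = M ∧ 2 ≤ (S.filter fun r => f r ∈ O).card).card
      = ∑ P ∈ S.powerset, if 2 ≤ P.card then O.card ^ P.card *
          (U.card - O.card) ^ (S.card - P.card) * U.card ^ (M.card - S.card)
        * (n - U.card) ^ (k - M.card) else 0 := by
    rw [Finset.card_eq_sum_card_fiberwise (f := fun f => S.filter fun r => f r ∈ O)
      (t := S.powerset)
      (fun f _ => Finset.mem_coe.2 (Finset.mem_powerset.2 (Finset.filter_subset _ _)))]
    refine Finset.sum_congr rfl fun P hP => ?_
    rw [Finset.filter_filter]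
    split_ifs with h2
    · rw [← card_targets hOU (Finset.mem_powerset.1 hP) hSM]
      congr 1
      refine Finset.filter_congr fun f _ => ?_
      constructor
      · rintro ⟨⟨h3, _⟩, h4⟩; exact ⟨h3, h4⟩
      · rintro ⟨h3, h4⟩; exact ⟨⟨h3, h4 ▸ h2⟩, h4⟩
    · rw [Finset.card_eq_zero, Finset.filter_eq_empty_iff]
      rintro f _ ⟨⟨_, h3⟩, h4⟩
      exact h2 (h4 ▸ h3)
  rw [h1, Finset.sum_powerset_apply_card (fun j => if 2 ≤ j then O.card ^ j *
          (U.card - O.card) ^ (S.card - j) * U.card ^ (M.card - S.card)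
        * (n - U.card) ^ (k - M.card) else 0), hS, card_targets_answered]
  simp only [Finset.sum_range_succ, Finset.sum_range_zero]
  norm_num [Nat.choose]
  rw [Nat.cast_sub hle]
  obtain ⟨j, hj⟩ := Nat.exists_eq_add_of_le hM
  rw [hj, Nat.add_sub_cancel_left, pow_add]
  rcases Nat.eq_zero_or_pos U.card with h0 | h0
  · have : O.card = 0 := by omega
    simp [h0, this]
  · have : (0 : ℝ) < U.card := by exact_mod_cast h0
    field_simp
    ring

/-! ### Medians of three replies -/

/-- The median of three values, characterised by a majority vote for every threshold. -/
theorem exists_median_of_card_eq_three {K : Type*} [LinearOrder K] (s : Multiset K)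
    (hs : s.card = 3) :
    ∃ m, median s = some m ∧ m ∈ s ∧ ∀ v, m ≤ v ↔ 2 ≤ s.countP (· ≤ v) := by
  obtain ⟨a, b, c, hl⟩ : ∃ a b c, s.sort (· ≤ ·) = [a, b, c] := by
    have : (s.sort (· ≤ ·)).length = 3 := by rw [Multiset.length_sort, hs]
    exact List.length_eq_three.1 this
  have hsl : s = (([a, b, c] : List K) : Multiset K) := by rw [← hl, Multiset.sort_eq]
  have hsorted := Multiset.pairwise_sort s (· ≤ ·)
  rw [hl] at hsorted
  simp only [List.pairwise_cons, List.mem_cons, List.not_mem_nil, or_false, forall_eq_or_imp,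
    forall_eq] at hsorted
  obtain ⟨⟨hab, hac⟩, hbc, -⟩ := hsorted
  refine ⟨b, ?_, ?_, fun v => ?_⟩
  · rw [median, hl, hs]; rfl
  · rw [hsl]; simp
  · rw [hsl, Multiset.coe_countP]
    simp only [List.countP_cons, List.countP_nil]
    by_cases h2 : b ≤ v
    · have h1 : a ≤ v := hab.trans h2
      simp [h1, h2]
    · have h3 : ¬ c ≤ v := fun h => h2 (hbc.trans h)
      simp only [h2, h3, decide_false]
      by_cases h1 : a ≤ v <;> simp [h1]

open Classical in
/-- The useful servers that hold a value of at most `v`. -/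
noncomputable def lowUseful {n : ℕ} {K : Type*} [LinearOrder K] (v : K) (B : Finset (Fin n))
    (x : Config n K) : Finset (Fin n) :=
  (useful B x).filter fun i => ∃ a, x i = some a ∧ a ≤ v

theorem lowUseful_subset {n : ℕ} {K : Type*} [LinearOrder K] (v : K) (B : Finset (Fin n))
    (x : Config n K) : lowUseful v B x ⊆ useful B x := Finset.filter_subset _ _

theorem median_replies {k n : ℕ} {K : Type*} [LinearOrder K] {B : Finset (Fin n)}
    {x : Config n K} {f : Fin k → Fin n} {S : Finset (Fin k)} (hS : S.card = 3)
    (hf : ∀ r ∈ S, f r ∈ useful B x) :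
    ∃ m, median (S.val.filterMap fun r => x (f r)) = some m ∧
      (∃ r ∈ S, x (f r) = some m) ∧
      ∀ v, m ≤ v ↔ 2 ≤ (S.filter fun r => f r ∈ lowUseful v B x).card := by
  classical
  obtain ⟨r₀, hr₀⟩ : S.Nonempty := by rw [← Finset.card_pos]; omega
  have hsome : ∀ r ∈ S, (x (f r)).isSome := fun r hr => (Finset.mem_filter.1 (hf r hr)).2.2
  obtain ⟨y, hy⟩ : ∃ y : Fin k → K, ∀ r ∈ S, x (f r) = some (y r) :=
    ⟨fun r => (x (f r)).getD ((x (f r₀)).get (hsome r₀ hr₀)), fun r hr => by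
      obtain ⟨a, ha⟩ := Option.isSome_iff_exists.1 (hsome r hr)
      simp [ha]⟩
  have e : (S.val.filterMap fun r => x (f r)) = S.val.map y := by
    rw [← Multiset.filterMap_eq_map]
    have : ∀ s : Multiset (Fin k), (∀ r ∈ s, x (f r) = some (y r)) →
        (s.filterMap fun r => x (f r)) = s.filterMap (some ∘ y) := by
      intro s
      induction s using Multiset.induction_on with
      | empty => simp
      | cons a s ih =>
        intro h
        rw [Multiset.filterMap_cons_some (fun r => x (f r)) _ _ (h a (Multiset.mem_cons_self a s)),
          Multiset.filterMap_cons_some (some ∘ y) a s rfl,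
          ih fun r hr => h r (Multiset.mem_cons_of_mem hr)]
    exact this S.val fun r hr => hy r hr
  obtain ⟨m, hm, hms, hmv⟩ := exists_median_of_card_eq_three (S.val.map y) (by simpa using hS)
  refine ⟨m, by rw [e, hm], ?_, fun v => ?_⟩
  · obtain ⟨r, hr, rfl⟩ := Multiset.mem_map.1 hms
    exact ⟨r, hr, hy r hr⟩
  · rw [hmv, Multiset.countP_map]
    have : (S.filter fun r => f r ∈ lowUseful v B x) = S.filter fun r => y r ≤ v := by
      refine Finset.filter_congr fun r hr => ?_
      simp only [lowUseful, Finset.mem_filter, hf r hr, hy r hr, true_and]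
      simp
    rw [this]
    rfl

/-! ### Counting draws -/

/-- The choice functions of a server: the second component of `Draw k ℓ n`. -/
abbrev Choice (k ℓ : ℕ) : Type :=
  (M : {M : Finset (Fin k) // ℓ ≤ M.card}) → {S : Finset (Fin k) // S ∈ M.1.powersetCard ℓ}

theorem sum_draw {k ℓ n : ℕ} {R : Type*} [AddCommMonoid R] (F : Draw k ℓ n → R) :
    ∑ d, F d = ∑ c : Choice k ℓ, ∑ f : Fin k → Fin n, F (f, c) := by
  rw [Finset.sum_comm]
  exact Fintype.sum_prod_type (f := (F : (Fin k → Fin n) × Choice k ℓ → R))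

theorem card_draw (k ℓ n : ℕ) :
    Fintype.card (Draw k ℓ n) = Fintype.card (Choice k ℓ) * n ^ k := by
  have := sum_draw (k := k) (ℓ := ℓ) (n := n) (fun _ => 1)
  simpa using this

/-- The requests that reach a server in `U`. If `U` is the set of useful servers, these are the
answered requests of a server that is not blocked. -/
def Draw.hits {k ℓ n : ℕ} (U : Finset (Fin n)) (d : Draw k ℓ n) : Finset (Fin k) :=
  Finset.univ.filter fun r => d.target r ∈ U

/-- The choice falls on a set of three answered requests with a majority of targets in `O`. -/
def Draw.IsLow {k n : ℕ} (U O : Finset (Fin n)) (d : Draw k 3 n) : Prop :=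
  ∃ h : 3 ≤ (d.hits U).card, 2 ≤ ((d.choice (d.hits U) h).filter fun r => d.target r ∈ O).card

open Classical in
theorem card_hits {k n : ℕ} (U : Finset (Fin n)) :
    (Finset.univ.filter fun d : Draw k 3 n => 3 ≤ (d.hits U).card).card
      = Fintype.card (Choice k 3) * (Finset.univ.filter fun f : Fin k → Fin n =>
          3 ≤ (Finset.univ.filter fun r => f r ∈ U).card).card := by
  rw [Finset.card_filter, sum_draw, ← smul_eq_mul, ← Finset.card_univ, ← Finset.sum_const]
  refine Finset.sum_congr rfl fun c _ => ?_
  rw [Finset.card_filter]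
  rfl

open Classical in
/-- Among the draws with at least three replies, the fraction of those with a low median is
`3 q ^ 2 - 2 q ^ 3`, where `q` is the fraction of low servers among the useful ones. -/
theorem card_isLow {k n : ℕ} {U O : Finset (Fin n)} (hOU : O ⊆ U) :
    ((Finset.univ.filter fun d : Draw k 3 n => d.IsLow U O).card : ℝ)
      = (3 * ((O.card : ℝ) / U.card) ^ 2 - 2 * ((O.card : ℝ) / U.card) ^ 3) *
        (Finset.univ.filter fun d : Draw k 3 n => 3 ≤ (d.hits U).card).card := by
  rw [card_hits, Finset.card_filter, sum_draw, Nat.cast_sum, Nat.cast_mul, mul_left_comm,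
    ← nsmul_eq_mul, ← Finset.card_univ, ← Finset.sum_const]
  refine Finset.sum_congr rfl fun c _ => ?_
  rw [← Finset.card_filter]
  rw [Finset.card_eq_sum_card_fiberwise
    (f := fun f : Fin k → Fin n => Finset.univ.filter fun r => f r ∈ U)
    (t := Finset.univ.filter fun M : Finset (Fin k) => 3 ≤ M.card)
    (fun f hf => by
      obtain ⟨h, -⟩ := (Finset.mem_filter.1 (Finset.mem_coe.1 hf)).2
      exact Finset.mem_coe.2 (Finset.mem_filter.2 ⟨Finset.mem_univ _, h⟩)),
    Finset.card_eq_sum_card_fiberwise (s := Finset.univ.filter fun f : Fin k → Fin n =>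
          3 ≤ (Finset.univ.filter fun r => f r ∈ U).card)
    (f := fun f : Fin k → Fin n => Finset.univ.filter fun r => f r ∈ U)
    (t := Finset.univ.filter fun M : Finset (Fin k) => 3 ≤ M.card)
    (fun f hf => Finset.mem_coe.2 (Finset.mem_filter.2 ⟨Finset.mem_univ _,
      (Finset.mem_filter.1 (Finset.mem_coe.1 hf)).2⟩)),
    Nat.cast_sum, Nat.cast_sum, Finset.mul_sum]
  refine Finset.sum_congr rfl fun M hM => ?_
  have hM3 : 3 ≤ M.card := (Finset.mem_filter.1 hM).2
  obtain ⟨hSM, hS⟩ := Finset.mem_powersetCard.1 (c ⟨M, hM3⟩).2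
  have := card_targets_majority (n := n) hOU hSM hS
  rw [Finset.filter_filter, Finset.filter_filter]
  refine Eq.trans (congrArg Nat.cast (congrArg Finset.card ?_)) (this.trans
    (congrArg _ (congrArg Nat.cast (congrArg Finset.card ?_))))
  · ext f
    simp only [Finset.mem_filter, Finset.mem_univ, true_and]
    constructor
    · rintro ⟨⟨h, h2⟩, rfl⟩
      exact ⟨rfl, h2⟩
    · rintro ⟨rfl, h2⟩
      exact ⟨⟨hM3, h2⟩, rfl⟩
  · ext f
    simp only [Finset.mem_filter, Finset.mem_univ, true_and]
    constructor
    · rintro rfl; exact ⟨hM3, rfl⟩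
    · rintro ⟨_, h⟩; exact h

/-! ### Independent outcomes -/

/-- The mean of a function on a finite type under the uniform distribution. -/
noncomputable def average {Ω : Type*} [Fintype Ω] (F : Ω → ℝ) : ℝ :=
  (∑ ρ, F ρ) / Fintype.card Ω

theorem average_mono {Ω : Type*} [Fintype Ω] {F G : Ω → ℝ} (h : ∀ ρ, F ρ ≤ G ρ) :
    average F ≤ average G := by
  unfold average
  gcongr
  exact h _

theorem average_mul_const {Ω : Type*} [Fintype Ω] (F : Ω → ℝ) (a : ℝ) :
    average (fun ρ => a * F ρ) = a * average F := by
  unfold average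
  rw [← Finset.mul_sum, mul_div_assoc]

open Classical in
/-- If every element of `S` independently succeeds with probability `p`, and a successful one is
low with probability `g`, then the number of successes is binomial and, given this number, so is
the number of low elements. The elements outside `S` do not succeed. -/
theorem average_outcomes {ι Ω : Type*} [Fintype ι] [DecidableEq ι] [Fintype Ω] [Nonempty Ω]
    (τ : ι → Ω → Option Prop) (S : Finset ι) (p g : ℝ)
    (hout : ∀ i ∉ S, ∀ d, τ i d = none)
    (htrue : ∀ i ∈ S, ((Finset.univ.filter fun d => τ i d = some True).card : ℝ)
      = p * g * Fintype.card Ω)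
    (hfalse : ∀ i ∈ S, ((Finset.univ.filter fun d => τ i d = some False).card : ℝ)
      = p * (1 - g) * Fintype.card Ω) (F : ℕ → ℕ → ℝ) :
    average (fun ρ : ι → Ω => F (Finset.univ.filter fun i => τ i (ρ i) ≠ none).card
        (Finset.univ.filter fun i => τ i (ρ i) = some True).card)
      = binomialMean p S.card fun k => binomialMean g k (F k) := by
  have hΩ : (0 : ℝ) < Fintype.card Ω := by exact_mod_cast Fintype.card_pos
  have hnone : ∀ i ∈ S, ((Finset.univ.filter fun d => τ i d = none).card : ℝ)
      = (1 - p) * Fintype.card Ω := by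
    intro i hi
    have h1 : (Finset.univ.filter fun d => τ i d = none).card
        + ((Finset.univ.filter fun d => τ i d = some True).card
        + (Finset.univ.filter fun d => τ i d = some False).card) = Fintype.card Ω := by
      rw [← Finset.card_union_of_disjoint, ← Finset.card_union_of_disjoint, ← Finset.card_univ]
      · congr 1
        ext d
        simp only [Finset.mem_union, Finset.mem_filter, Finset.mem_univ, true_and, iff_true]
        rcases τ i d with _ | P
        · simp
        · by_cases hP : P <;> simp [hP]
      · rw [Finset.disjoint_left]
        intro d hd
        have := (Finset.mem_filter.1 hd).2
        simp [this]
      · rw [Finset.disjoint_left]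
        intro d hd
        have := (Finset.mem_filter.1 hd).2
        simp [this]
    have h2 : ((Finset.univ.filter fun d => τ i d = none).card : ℝ)
        + (((Finset.univ.filter fun d => τ i d = some True).card : ℝ)
        + ((Finset.univ.filter fun d => τ i d = some False).card : ℝ)) = Fintype.card Ω := by
      exact_mod_cast h1
    rw [htrue i hi, hfalse i hi] at h2
    linarith
  -- the number of draws with a given set `D` of successes and a given set `O` of low elements
  have hcount : ∀ D O : Finset ι, D ⊆ S → O ⊆ D →
      ((Finset.univ.filter fun ρ : ι → Ω => (Finset.univ.filter fun i => τ i (ρ i) ≠ none) = D ∧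
        (Finset.univ.filter fun i => τ i (ρ i) = some True) = O).card : ℝ)
        = (g ^ O.card * (1 - g) ^ (D.card - O.card)) *
          (p ^ D.card * (1 - p) ^ (S.card - D.card)) * (Fintype.card Ω : ℝ) ^ Fintype.card ι := by
    intro D O hDS hOD
    have h : (Finset.univ.filter fun ρ : ι → Ω =>
        (Finset.univ.filter fun i => τ i (ρ i) ≠ none) = D ∧
        (Finset.univ.filter fun i => τ i (ρ i) = some True) = O)
        = Fintype.piFinset fun i => Finset.univ.filter fun d => τ i d =
          if i ∈ O then some True else if i ∈ D then some False else none := by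
      ext ρ
      simp only [Finset.mem_filter, Finset.mem_univ, true_and, Fintype.mem_piFinset,
        Finset.ext_iff]
      rw [← forall_and]
      refine forall_congr' fun i => ?_
      have hi := @hOD i
      rcases hτ : τ i (ρ i) with _ | P
      · by_cases h1 : i ∈ O <;> by_cases h2 : i ∈ D <;> simp_all
      · by_cases hP : P <;> by_cases h1 : i ∈ O <;> by_cases h2 : i ∈ D <;> simp_all
    rw [h, Fintype.card_piFinset, Nat.cast_prod]
    have e : ∀ i, ((Finset.univ.filter fun d => τ i d =
          if i ∈ O then some True else if i ∈ D then some False else none).card : ℝ)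
        = (if i ∈ O then p * g else if i ∈ D then p * (1 - g) else if i ∈ S then 1 - p else 1)
          * Fintype.card Ω := by
      intro i
      by_cases h1 : i ∈ O
      · simp only [h1, if_true]; exact htrue i (hDS (hOD h1))
      · by_cases h2 : i ∈ D
        · simp only [h1, h2, if_true, if_false]; exact hfalse i (hDS h2)
        · by_cases h3 : i ∈ S
          · simp only [h1, h2, h3, if_true, if_false]; exact hnone i h3
          · simp only [h1, h2, h3, if_false]
            rw [Finset.filter_true_of_mem fun d _ => hout i h3 d, one_mul, Finset.card_univ]
    simp only [e]
    rw [Finset.prod_mul_distrib, prod_ite_chain hOD hDS, Finset.prod_const, Finset.card_univ,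
      one_pow, mul_one, mul_pow, mul_pow]
    obtain ⟨j, hj⟩ := Nat.exists_eq_add_of_le (Finset.card_le_card hOD)
    rw [hj, Nat.add_sub_cancel_left, pow_add]
    ring
  have hsub : ∀ ρ : ι → Ω, (Finset.univ.filter fun i => τ i (ρ i) ≠ none) ⊆ S := by
    intro ρ i hi
    by_contra h
    exact (Finset.mem_filter.1 hi).2 (hout i h _)
  have hsub' : ∀ ρ : ι → Ω, (Finset.univ.filter fun i => τ i (ρ i) = some True) ⊆
      Finset.univ.filter fun i => τ i (ρ i) ≠ none := by
    intro ρ i hi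
    have := (Finset.mem_filter.1 hi).2
    simp [this]
  have hsum : ∑ ρ : ι → Ω, F (Finset.univ.filter fun i => τ i (ρ i) ≠ none).card
        (Finset.univ.filter fun i => τ i (ρ i) = some True).card
      = ∑ D ∈ S.powerset, ∑ O ∈ D.powerset,
        ((Finset.univ.filter fun ρ : ι → Ω =>
          (Finset.univ.filter fun i => τ i (ρ i) ≠ none) = D ∧
          (Finset.univ.filter fun i => τ i (ρ i) = some True) = O).card : ℝ)
            * F D.card O.card := by
    have h1 : ∀ ρ : ι → Ω, F (Finset.univ.filter fun i => τ i (ρ i) ≠ none).card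
        (Finset.univ.filter fun i => τ i (ρ i) = some True).card
        = ∑ D ∈ S.powerset, ∑ O ∈ D.powerset,
          if (Finset.univ.filter fun i => τ i (ρ i) ≠ none) = D ∧
          (Finset.univ.filter fun i => τ i (ρ i) = some True) = O then F D.card O.card else 0 := by
      intro ρ
      rw [Finset.sum_eq_single_of_mem _ (Finset.mem_powerset.2 (hsub ρ)),
        Finset.sum_eq_single_of_mem _ (Finset.mem_powerset.2 (hsub' ρ)), if_pos ⟨rfl, rfl⟩]
      · intro O _ hO
        exact if_neg fun h => hO h.2.symm
      · intro D _ hD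
        exact Finset.sum_eq_zero fun O _ => if_neg fun h => hD h.1.symm
    rw [Finset.sum_congr rfl fun ρ _ => h1 ρ, Finset.sum_comm]
    refine Finset.sum_congr rfl fun D _ => ?_
    rw [Finset.sum_comm]
    refine Finset.sum_congr rfl fun O _ => ?_
    rw [← Finset.sum_filter, Finset.sum_const, nsmul_eq_mul]
  rw [average, hsum, ← sum_powerset_eq_binomialMean, Fintype.card_fun, Nat.cast_pow,
    div_eq_iff (pow_pos hΩ _).ne', Finset.sum_mul]
  refine Finset.sum_congr rfl fun D hD => ?_
  rw [← sum_powerset_eq_binomialMean, Finset.mul_sum, Finset.sum_mul]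
  refine Finset.sum_congr rfl fun O hO => ?_
  rw [hcount D O (Finset.mem_powerset.1 hD) (Finset.mem_powerset.1 hO)]
  ring

/-! ### One round of the median rule -/

theorem answered_eq_hits {k ℓ n : ℕ} {K : Type*} {B : Finset (Fin n)} (x : Config n K)
    {i : Fin n} (hi : i ∉ B) (d : Draw k ℓ n) : answered B x i d = d.hits (useful B x) := by
  simp [answered, Draw.hits, hi]

section Round

variable {n : ℕ} {K : Type u} [LinearOrder K]

theorem step_eq_none_of_mem {k : ℕ} {B : Finset (Fin n)} (x : Config n K)
    (ρ : Fin n → Draw k 3 n) {i : Fin n} (hi : i ∈ B) : step B x ρ i = none := by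
  rw [step, dif_neg]
  have : answered B x i (ρ i) = ∅ := by
    rw [answered, Finset.filter_eq_empty_iff]
    exact fun r _ h => h.1 hi
  rw [this]
  simp

theorem step_eq_none {k : ℕ} {B : Finset (Fin n)} (x : Config n K) (ρ : Fin n → Draw k 3 n)
    {i : Fin n} (h : ¬ 3 ≤ ((ρ i).hits (useful B x)).card) : step B x ρ i = none := by
  by_cases hi : i ∈ B
  · exact step_eq_none_of_mem x ρ hi
  · rw [step, dif_neg]
    rwa [answered_eq_hits x hi]

theorem exists_step_eq_some {k : ℕ} {B : Finset (Fin n)} (x : Config n K)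
    (ρ : Fin n → Draw k 3 n) {i : Fin n} (hi : i ∉ B)
    (h : 3 ≤ ((ρ i).hits (useful B x)).card) :
    ∃ m, step B x ρ i = some m ∧ (∃ j ∈ useful B x, x j = some m) ∧
      ∀ v, m ≤ v ↔ (ρ i).IsLow (useful B x) (lowUseful v B x) := by
  obtain ⟨hSM, hS⟩ := Finset.mem_powersetCard.1 ((ρ i).2 ⟨_, h⟩).2
  have hf : ∀ r ∈ (ρ i).choice _ h, (ρ i).target r ∈ useful B x := fun r hr =>
    (Finset.mem_filter.1 (hSM hr)).2
  obtain ⟨m, hm, ⟨r, hr, hrm⟩, hmv⟩ := median_replies hS hf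
  refine ⟨m, ?_, ⟨_, hf r hr, hrm⟩, fun v => (hmv v).trans ⟨fun h2 => ⟨h, h2⟩, fun h2 => h2.2⟩⟩
  have h' : 3 ≤ (answered B x i (ρ i)).card := by rwa [answered_eq_hits x hi]
  rw [step, dif_pos h', ← hm]
  have e := answered_eq_hits x hi (ρ i)
  congr 3
  simp only [e]
  rfl

/-- A value that is adopted was held by a useful server. -/
theorem exists_mem_useful_of_step {k : ℕ} {B : Finset (Fin n)} {x : Config n K}
    {ρ : Fin n → Draw k 3 n} {i : Fin n} {m : K} (h : step B x ρ i = some m) :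
    ∃ j ∈ useful B x, x j = some m := by
  by_cases hi : i ∈ B
  · rw [step_eq_none_of_mem x ρ hi] at h; cases h
  · by_cases h3 : 3 ≤ ((ρ i).hits (useful B x)).card
    · obtain ⟨m', hm', hj, -⟩ := exists_step_eq_some x ρ hi h3
      rw [hm'] at h
      cases h
      exact hj
    · rw [step_eq_none x ρ h3] at h; cases h

open Classical in
/-- The probability that a server gets at least three replies, if the servers in `U` reply. -/
noncomputable def replyProb (U : Finset (Fin n)) : ℝ :=
  ((Finset.univ.filter fun d : Draw 6 3 n => 3 ≤ (d.hits U).card).card : ℝ)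
    / Fintype.card (Draw 6 3 n)

/-- The probability that the median of three samples is low, if a fraction `q` of the population
is low. -/
noncomputable def medianProb (q : ℝ) : ℝ := 3 * q ^ 2 - 2 * q ^ 3

/-- The joint distribution of the numbers of useful and of low servers after one round, where the
set `B'` of servers that will be blocked next is already known: the former number is binomial and,
given the former, the latter is binomial. -/
theorem average_step [NeZero n] (B B' : Finset (Fin n)) (x : Config n K) (v : K)
    (F : ℕ → ℕ → ℝ) :
    average (fun ρ : Fin n → Draw 6 3 n =>
        F (useful B' (step B x ρ)).card (lowUseful v B' (step B x ρ)).card)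
      = binomialMean (replyProb (useful B x)) (B ∪ B')ᶜ.card fun k =>
          binomialMean (medianProb ((lowUseful v B x).card / (useful B x).card)) k (F k) := by
  classical
  -- the outcome at a server: `none` if it is not useful, otherwise whether its value is low
  let τ : Fin n → Draw 6 3 n → Option Prop := fun i d =>
    if i ∈ B' then none else (step B x (fun _ => d) i).map (· ≤ v)
  have hΩ : (0 : ℝ) < Fintype.card (Draw 6 3 n) := by exact_mod_cast Fintype.card_pos
  have hτ : ∀ i ∉ B ∪ B', ∀ d,
      (3 ≤ (d.hits (useful B x)).card →
        τ i d = some (d.IsLow (useful B x) (lowUseful v B x))) ∧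
      (¬ 3 ≤ (d.hits (useful B x)).card → τ i d = none) := by
    intro i hi d
    rw [Finset.mem_union, not_or] at hi
    constructor
    · intro h
      obtain ⟨m, hm, -, hmv⟩ := exists_step_eq_some x (fun _ => d) hi.1 h
      simp only [τ, hi.2, if_false, hm, Option.map_some, hmv]
    · intro h
      simp only [τ, hi.2, if_false, step_eq_none x (fun _ => d) h, Option.map_none]
  have hlow : ∀ d : Draw 6 3 n, d.IsLow (useful B x) (lowUseful v B x) →
      3 ≤ (d.hits (useful B x)).card := fun d h => h.1
  have hcard := card_isLow (k := 6) (lowUseful_subset v B x)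
  have h1 : ∀ ρ : Fin n → Draw 6 3 n, useful B' (step B x ρ) =
      Finset.univ.filter fun i => τ i (ρ i) ≠ none := by
    intro ρ
    ext i
    rw [useful, Finset.mem_filter, Finset.mem_filter]
    change _ ∧ i ∉ B' ∧ (step B x (fun _ => ρ i) i).isSome = true ↔ _
    by_cases hi : i ∈ B'
    · simp [τ, hi]
    · simp only [τ, hi, if_false]
      cases step B x (fun _ => ρ i) i <;> simp
  have h2 : ∀ ρ : Fin n → Draw 6 3 n, lowUseful v B' (step B x ρ) =
      Finset.univ.filter fun i => τ i (ρ i) = some True := by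
    intro ρ
    ext i
    rw [lowUseful, Finset.mem_filter, useful, Finset.mem_filter, Finset.mem_filter]
    change (_ ∧ i ∉ B' ∧ (step B x (fun _ => ρ i) i).isSome = true) ∧
      (∃ a, step B x (fun _ => ρ i) i = some a ∧ a ≤ v) ↔ _
    by_cases hi : i ∈ B'
    · simp [τ, hi]
    · simp only [τ, hi, if_false]
      cases step B x (fun _ => ρ i) i <;> simp
  simp only [h1, h2]
  refine average_outcomes τ (B ∪ B')ᶜ (replyProb (useful B x))
    (medianProb ((lowUseful v B x).card / (useful B x).card)) ?_ ?_ ?_ F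
  · intro i hi d
    have hi' : i ∈ B ∪ B' := by
      by_contra h
      exact hi (Finset.mem_compl.2 h)
    by_cases h : i ∈ B'
    · simp [τ, h]
    · have : i ∈ B := by simpa [h] using hi'
      simp [τ, step_eq_none_of_mem x (fun _ => d) this]
  · intro i hi
    have hi' : i ∉ B ∪ B' := by simpa using hi
    have e : (Finset.univ.filter fun d => τ i d = some True)
        = Finset.univ.filter fun d : Draw 6 3 n => d.IsLow (useful B x) (lowUseful v B x) := by
      refine Finset.filter_congr fun d _ => ?_
      by_cases h : 3 ≤ (d.hits (useful B x)).card
      · simp [(hτ i hi' d).1 h]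
      · simp [(hτ i hi' d).2 h, mt (hlow d) h]
    rw [e, hcard, replyProb, medianProb]
    field_simp
  · intro i hi
    have hi' : i ∉ B ∪ B' := by simpa using hi
    have e : (Finset.univ.filter fun d => τ i d = some False)
        = (Finset.univ.filter fun d : Draw 6 3 n => 3 ≤ (d.hits (useful B x)).card) \
          Finset.univ.filter fun d : Draw 6 3 n => d.IsLow (useful B x) (lowUseful v B x) := by
      ext d
      simp only [Finset.mem_sdiff, Finset.mem_filter, Finset.mem_univ, true_and]
      by_cases h : 3 ≤ (d.hits (useful B x)).card
      · simp [(hτ i hi' d).1 h, h]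
      · simp [(hτ i hi' d).2 h, h]
    have hsub : (Finset.univ.filter fun d : Draw 6 3 n =>
        d.IsLow (useful B x) (lowUseful v B x)) ⊆
        Finset.univ.filter fun d : Draw 6 3 n => 3 ≤ (d.hits (useful B x)).card := fun d hd =>
      Finset.mem_filter.2 ⟨Finset.mem_univ _, hlow d (Finset.mem_filter.1 hd).2⟩
    rw [e, Finset.card_sdiff_of_subset hsub, Nat.cast_sub (Finset.card_le_card hsub), hcard,
      replyProb, medianProb]
    field_simp

theorem replyProb_nonneg (U : Finset (Fin n)) : 0 ≤ replyProb U := by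
  unfold replyProb; positivity

theorem replyProb_le_one (U : Finset (Fin n)) : replyProb U ≤ 1 := by
  unfold replyProb
  refine div_le_one_of_le₀ ?_ (Nat.cast_nonneg _)
  exact_mod_cast Finset.card_le_univ _

theorem replyProb_eq [NeZero n] (U : Finset (Fin n)) :
    replyProb U = 20 * ((U.card : ℝ) / n) ^ 3 - 45 * ((U.card : ℝ) / n) ^ 4
      + 36 * ((U.card : ℝ) / n) ^ 5 - 10 * ((U.card : ℝ) / n) ^ 6 := by
  classical
  have hΩ : (0 : ℝ) < Fintype.card (Draw 6 3 n) := by exact_mod_cast Fintype.card_pos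
  have hle : U.card ≤ n := by simpa using Finset.card_le_univ U
  have hn : (0 : ℝ) < n := by exact_mod_cast Nat.pos_of_ne_zero (NeZero.ne n)
  have hcard : (Finset.univ.filter fun f : Fin 6 → Fin n =>
      3 ≤ (Finset.univ.filter fun r => f r ∈ U).card).card
      = 20 * (U.card ^ 3 * (n - U.card) ^ 3) + 15 * (U.card ^ 4 * (n - U.card) ^ 2)
        + 6 * (U.card ^ 5 * (n - U.card)) + U.card ^ 6 := by
    rw [Finset.card_eq_sum_card_fiberwise
      (f := fun f : Fin 6 → Fin n => Finset.univ.filter fun r => f r ∈ U)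
      (t := (Finset.univ : Finset (Fin 6)).powerset) (fun f _ => by simp)]
    have h1 : ∀ M ∈ (Finset.univ : Finset (Fin 6)).powerset,
        ((Finset.univ.filter fun f : Fin 6 → Fin n =>
          3 ≤ (Finset.univ.filter fun r => f r ∈ U).card).filter fun f =>
            (Finset.univ.filter fun r => f r ∈ U) = M).card
        = if 3 ≤ M.card then U.card ^ M.card * (n - U.card) ^ (6 - M.card) else 0 := by
      intro M _
      rw [Finset.filter_filter]
      split_ifs with h3
      · rw [← card_targets_answered]
        refine congrArg Finset.card (Finset.filter_congr fun f _ => ?_)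
        exact ⟨fun h => h.2, fun h => ⟨h ▸ h3, h⟩⟩
      · rw [Finset.card_eq_zero, Finset.filter_eq_empty_iff]
        rintro f _ ⟨h, h'⟩
        exact h3 (h' ▸ h)
    rw [Finset.sum_congr rfl h1, Finset.sum_powerset_apply_card
      (fun j => if 3 ≤ j then U.card ^ j * (n - U.card) ^ (6 - j) else 0)]
    simp [Finset.sum_range_succ, Nat.choose]
  have hC : (0 : ℝ) < Fintype.card (Choice 6 3) := by
    have := hΩ
    rw [card_draw] at this
    push_cast at this
    exact pos_of_mul_pos_left this (by positivity)
  rw [replyProb, card_hits, hcard, card_draw]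
  push_cast [Nat.cast_sub hle]
  field_simp
  ring

/-- Below a quarter of useful servers, the expected number of servers that get at least three
replies is smaller by a constant factor than the number of useful servers. -/
theorem replyProb_le [NeZero n] {U : Finset (Fin n)} (hU : 4 * U.card ≤ n) :
    replyProb U ≤ 7 / 10 * ((U.card : ℝ) / n) := by
  have hn : (0 : ℝ) < n := by exact_mod_cast Nat.pos_of_ne_zero (NeZero.ne n)
  rw [replyProb_eq]
  obtain ⟨y, hy⟩ : ∃ y : ℝ, y = (U.card : ℝ) / n := ⟨_, rfl⟩
  rw [← hy]
  have h0 : 0 ≤ y := by rw [hy]; positivity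
  have h1 : y ≤ 1 / 4 := by
    rw [hy, div_le_iff₀ hn]
    have : (4 : ℝ) * U.card ≤ n := by exact_mod_cast hU
    linarith
  have h2 : 20 * y ^ 2 - 45 * y ^ 3 + 36 * y ^ 4 ≤ 7 / 10 := by
    nlinarith [mul_nonneg h0 (sub_nonneg.2 h1), mul_nonneg (mul_nonneg h0 h0) (sub_nonneg.2 h1),
      mul_nonneg (mul_nonneg (mul_nonneg h0 h0) h0) (sub_nonneg.2 h1)]
  nlinarith [mul_le_mul_of_nonneg_left h2 h0, pow_nonneg h0 6]

end Round

/-! ### Averaging over the draws of one round -/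

/-- Resampling one coordinate does not change an infinite product measure. -/
theorem measurePreserving_update_infinitePi {X : Type*} [MeasurableSpace X] (ν : Measure X)
    [IsProbabilityMeasure ν] (t : ℕ) :
    MeasurePreserving (fun q : (ℕ → X) × X => Function.update q.1 t q.2)
      ((Measure.infinitePi fun _ : ℕ => ν).prod ν) (Measure.infinitePi fun _ : ℕ => ν) := by
  have hmeas : Measurable fun q : (ℕ → X) × X => Function.update q.1 t q.2 := by
    refine measurable_pi_iff.2 fun s => ?_
    by_cases h : s = t
    · subst h
      simpa using measurable_snd
    · simp only [Function.update_of_ne h]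
      exact (measurable_pi_apply s).comp measurable_fst
  refine ⟨hmeas, Measure.eq_infinitePi _ fun s A hA => ?_⟩
  classical
  rw [Measure.map_apply hmeas (MeasurableSet.pi s.countable_toSet fun i _ => hA i)]
  have e : (fun q : (ℕ → X) × X => Function.update q.1 t q.2) ⁻¹' (Set.pi s A)
      = (Set.pi (s.erase t : Finset ℕ) A) ×ˢ (if t ∈ s then A t else Set.univ) := by
    ext q
    simp only [Set.mem_preimage, Set.mem_pi, Set.mem_prod, Finset.coe_erase, Finset.mem_coe,
      Set.mem_sdiff, Set.mem_singleton_iff]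
    constructor
    · intro h
      refine ⟨fun i hi => by simpa [hi.2] using h i hi.1, ?_⟩
      split_ifs with hs
      · simpa using h t hs
      · trivial
    · rintro ⟨h1, h2⟩ i hi
      by_cases hit : i = t
      · subst hit
        simpa [hi] using h2
      · simpa [hit] using h1 i ⟨hi, hit⟩
  rw [e, Measure.prod_prod, Measure.infinitePi_pi _ fun i _ => hA i]
  split_ifs with hs
  · rw [mul_comm, Finset.mul_prod_erase s (fun i => ν (A i)) hs]
  · rw [measure_univ, mul_one, Finset.erase_eq_of_notMem hs]

/-- A function of finitely many coordinates in a finite space is measurable. -/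
theorem measurable_of_dependsOn_Iio {X Y : Type*} [MeasurableSpace X] [Finite X] [Nonempty X]
    [MeasurableSingletonClass X] [MeasurableSpace Y] {t : ℕ} {g : (ℕ → X) → Y}
    (hg : DependsOn g (Set.Iio t)) : Measurable g := by
  let x₀ : X := Classical.arbitrary X
  let h : (Fin t → X) → Y := fun y => g fun s => if hs : s < t then y ⟨s, hs⟩ else x₀
  have e : g = h ∘ fun (ω : ℕ → X) (s : Fin t) => ω s := by
    ext ω
    refine hg fun s hs => ?_
    simp [Set.mem_Iio.1 hs]
  rw [e]
  exact (measurable_of_finite h).comp (measurable_pi_lambda _ fun s => measurable_pi_apply _)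

instance (k ℓ n : ℕ) : MeasurableSingletonClass (Draw k ℓ n) := ⟨fun _ => trivial⟩

instance (k ℓ n : ℕ) [NeZero n] : IsProbabilityMeasure (drawMeasure k ℓ n) := by
  unfold drawMeasure; infer_instance

/-- The distribution of the choices of all servers in one round. -/
noncomputable def roundMeasure (k ℓ n : ℕ) [NeZero n] : Measure (Fin n → Draw k ℓ n) :=
  Measure.pi fun _ : Fin n => (PMF.uniformOfFintype (Draw k ℓ n)).toMeasure

instance (k ℓ n : ℕ) [NeZero n] : IsProbabilityMeasure (roundMeasure k ℓ n) := by
  unfold roundMeasure; infer_instance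

theorem lintegral_roundMeasure {k ℓ n : ℕ} [NeZero n] {g : (Fin n → Draw k ℓ n) → ℝ}
    (hg : ∀ ρ, 0 ≤ g ρ) :
    ∫⁻ ρ, ENNReal.ofReal (g ρ) ∂roundMeasure k ℓ n = ENNReal.ofReal (average g) := by
  have hΩ : (0 : ℝ) < Fintype.card (Draw k ℓ n) := by exact_mod_cast Fintype.card_pos
  have hs : ∀ ρ : Fin n → Draw k ℓ n, roundMeasure k ℓ n {ρ}
      = ENNReal.ofReal ((Fintype.card (Fin n → Draw k ℓ n) : ℝ)⁻¹) := by
    intro ρ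
    rw [roundMeasure, Measure.pi_singleton]
    simp only [PMF.toMeasure_apply_singleton _ _ (measurableSet_singleton _),
      PMF.uniformOfFintype_apply, Finset.prod_const, Finset.card_univ, Fintype.card_fun,
      Fintype.card_fin]
    rw [Nat.cast_pow, ← inv_pow, ENNReal.ofReal_pow (by positivity),
      ENNReal.ofReal_inv_of_pos hΩ, ENNReal.ofReal_natCast]
  rw [lintegral_fintype]
  simp only [hs]
  rw [average, div_eq_mul_inv, Finset.sum_mul,
    ENNReal.ofReal_sum_of_nonneg fun ρ _ => mul_nonneg (hg ρ) (by positivity)]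
  refine Finset.sum_congr rfl fun ρ _ => ?_
  rw [ENNReal.ofReal_mul (hg ρ)]

/-- The drift principle: a bound on the mean over the choices of round `t`, for fixed choices in
the other rounds, gives a bound on the mean over all choices. -/
theorem lintegral_le_of_average_le {k ℓ n : ℕ} [NeZero n] {t : ℕ} {f g : Draws k ℓ n → ℝ} {r : ℝ}
    (hr : 0 ≤ r) (hg0 : ∀ ω, 0 ≤ g ω) (hg : DependsOn g (Set.Iio (t + 1)))
    (hf : DependsOn f (Set.Iio t))
    (h : ∀ ω, average (fun ρ => g (Function.update ω t ρ)) ≤ r * f ω) :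
    ∫⁻ ω, ENNReal.ofReal (g ω) ∂drawMeasure k ℓ n
      ≤ ENNReal.ofReal r * ∫⁻ ω, ENNReal.ofReal (f ω) ∂drawMeasure k ℓ n := by
  have hmp := measurePreserving_update_infinitePi (roundMeasure k ℓ n) t
  have hgm : Measurable fun ω => ENNReal.ofReal (g ω) :=
    (measurable_of_dependsOn_Iio hg).ennreal_ofReal
  have hfm : Measurable fun ω => ENNReal.ofReal (f ω) :=
    (measurable_of_dependsOn_Iio hf).ennreal_ofReal
  calc ∫⁻ ω, ENNReal.ofReal (g ω) ∂drawMeasure k ℓ n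
      = ∫⁻ q : Draws k ℓ n × (Fin n → Draw k ℓ n), ENNReal.ofReal (g (Function.update q.1 t q.2))
          ∂(drawMeasure k ℓ n).prod (roundMeasure k ℓ n) := (hmp.lintegral_comp hgm).symm
    _ = ∫⁻ ω, ∫⁻ ρ, ENNReal.ofReal (g (Function.update ω t ρ)) ∂roundMeasure k ℓ n
          ∂drawMeasure k ℓ n :=
        lintegral_prod _ (hgm.comp hmp.measurable).aemeasurable
    _ ≤ ∫⁻ ω, ENNReal.ofReal r * ENNReal.ofReal (f ω) ∂drawMeasure k ℓ n := by
        refine lintegral_mono fun ω => ?_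
        rw [lintegral_roundMeasure fun ρ => hg0 _, ← ENNReal.ofReal_mul hr]
        exact ENNReal.ofReal_le_ofReal (h ω)
    _ = _ := lintegral_const_mul _ hfm

/-- Markov's inequality for the drift principle. -/
theorem measure_le_of_lintegral_le {k ℓ n : ℕ} [NeZero n] {t : ℕ} {g : Draws k ℓ n → ℝ} {a b : ℝ}
    (ha : 0 < a) (hg : DependsOn g (Set.Iio t))
    (h : ∫⁻ ω, ENNReal.ofReal (g ω) ∂drawMeasure k ℓ n ≤ ENNReal.ofReal b)
    {s : Set (Draws k ℓ n)} (hs : ∀ ω ∈ s, a ≤ g ω) :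
    drawMeasure k ℓ n s ≤ ENNReal.ofReal (b / a) := by
  have hgm : Measurable fun ω => ENNReal.ofReal (g ω) :=
    (measurable_of_dependsOn_Iio hg).ennreal_ofReal
  calc drawMeasure k ℓ n s
      ≤ drawMeasure k ℓ n {ω | ENNReal.ofReal a ≤ ENNReal.ofReal (g ω)} :=
        measure_mono fun ω hω => ENNReal.ofReal_le_ofReal (hs ω hω)
    _ ≤ (∫⁻ ω, ENNReal.ofReal (g ω) ∂drawMeasure k ℓ n) / ENNReal.ofReal a :=
        meas_ge_le_lintegral_div hgm.aemeasurable (by simpa using ha) ENNReal.ofReal_ne_top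
    _ ≤ ENNReal.ofReal b / ENNReal.ofReal a := by gcongr
    _ = ENNReal.ofReal (b / a) := (ENNReal.ofReal_div_of_pos ha).symm

/-! ### The process against a late adversary -/

section Rounds

variable {n : ℕ} {K : Type u} [LinearOrder K] {x₀ : Fin n → K} {A : Adversary 6 3 n}

theorem Adversary.IsLate.dependsOn (hA : A.IsLate 1) (t : ℕ) : DependsOn (A (t + 1)) (Set.Iio t) :=
  fun ω ω' h => hA (t + 1) ω ω' fun s hs => h s (by simpa using hs)

theorem Adversary.IsLate.dependsOn_self (hA : A.IsLate 1) (t : ℕ) : DependsOn (A t) (Set.Iio t) :=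
  fun ω ω' h => hA t ω ω' fun s hs => h s (Set.mem_Iio.2 (by omega))

theorem dependsOn_config (x₀ : Fin n → K) (hA : A.IsLate 1) (t : ℕ) :
    DependsOn (fun ω => config A x₀ ω t) (Set.Iio t) := by
  induction t with
  | zero => intro ω ω' _; rfl
  | succ t ih =>
    intro ω ω' h
    have h' : ∀ s ∈ Set.Iio t, ω s = ω' s := fun s hs => h s (Set.mem_Iio.2 (by
      have := Set.mem_Iio.1 hs; omega))
    have h1 : config A x₀ ω t = config A x₀ ω' t := ih h'
    change step (A t ω) (config A x₀ ω t) (ω t) = step (A t ω') (config A x₀ ω' t) (ω' t)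
    rw [h1, hA.dependsOn_self t h', h t (Set.mem_Iio.2 (Nat.lt_succ_self t))]

/-- The useful servers with a value of at most `v` in round `t`. -/
noncomputable def lowAt (v : K) (A : Adversary 6 3 n) (x₀ : Fin n → K) (ω : Draws 6 3 n) (t : ℕ) :
    Finset (Fin n) :=
  lowUseful v (A t ω) (config A x₀ ω t)

theorem usefulAt_congr (hA : A.IsLate 1) {t : ℕ} {ω ω' : Draws 6 3 n}
    (h : ∀ s < t, ω s = ω' s) : usefulAt A x₀ ω t = usefulAt A x₀ ω' t := by
  have h1 : config A x₀ ω t = config A x₀ ω' t := dependsOn_config x₀ hA t fun s hs => h s hs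
  rw [usefulAt, usefulAt, h1, hA.dependsOn_self t fun s hs => h s hs]

theorem lowAt_congr (v : K) (hA : A.IsLate 1) {t : ℕ} {ω ω' : Draws 6 3 n}
    (h : ∀ s < t, ω s = ω' s) : lowAt v A x₀ ω t = lowAt v A x₀ ω' t := by
  have h1 : config A x₀ ω t = config A x₀ ω' t := dependsOn_config x₀ hA t fun s hs => h s hs
  rw [lowAt, lowAt, h1, hA.dependsOn_self t fun s hs => h s hs]

theorem usefulAt_update_of_le (hA : A.IsLate 1) {s t : ℕ} (hst : s ≤ t) (ω : Draws 6 3 n)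
    (ρ : Fin n → Draw 6 3 n) :
    usefulAt A x₀ (Function.update ω t ρ) s = usefulAt A x₀ ω s :=
  usefulAt_congr hA fun _ hr => Function.update_of_ne (by omega) _ _

theorem config_update (hA : A.IsLate 1) (ω : Draws 6 3 n) (t : ℕ) (ρ : Fin n → Draw 6 3 n) :
    config A x₀ (Function.update ω t ρ) (t + 1) = step (A t ω) (config A x₀ ω t) ρ := by
  have h : ∀ s ∈ Set.Iio t, Function.update ω t ρ s = ω s := fun s hs =>
    Function.update_of_ne (Set.mem_Iio.1 hs).ne _ _
  have h1 : config A x₀ (Function.update ω t ρ) t = config A x₀ ω t := dependsOn_config x₀ hA t h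
  change step _ _ _ = _
  rw [h1, hA.dependsOn_self t h, Function.update_self]

/-- Lateness: the servers that are blocked in round `t + 1` do not depend on the draws of
round `t`. -/
theorem blocked_update (hA : A.IsLate 1) (ω : Draws 6 3 n) (t : ℕ) (ρ : Fin n → Draw 6 3 n) :
    A (t + 1) (Function.update ω t ρ) = A (t + 1) ω :=
  hA.dependsOn t fun _ hs => Function.update_of_ne (Set.mem_Iio.1 hs).ne _ _

/-- The transition of the process, in terms of the binomial mean. -/
theorem average_round [NeZero n] (hA : A.IsLate 1) (v : K) (ω : Draws 6 3 n) (t : ℕ)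
    (F : ℕ → ℕ → ℝ) :
    average (fun ρ : Fin n → Draw 6 3 n =>
        F (usefulAt A x₀ (Function.update ω t ρ) (t + 1)).card
          (lowAt v A x₀ (Function.update ω t ρ) (t + 1)).card)
      = binomialMean (replyProb (usefulAt A x₀ ω t)) (A t ω ∪ A (t + 1) ω)ᶜ.card fun k =>
          binomialMean (medianProb ((lowAt v A x₀ ω t).card / (usefulAt A x₀ ω t).card)) k
            (F k) := by
  simp only [usefulAt, lowAt, config_update hA, blocked_update hA]
  exact average_step _ _ _ _ _

theorem lowAt_subset (v : K) (ω : Draws 6 3 n) (t : ℕ) :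
    lowAt v A x₀ ω t ⊆ usefulAt A x₀ ω t := lowUseful_subset _ _ _

/-- The fraction of the useful servers in round `t` that hold a value of at most `v`. -/
noncomputable def lowFraction (v : K) (A : Adversary 6 3 n) (x₀ : Fin n → K) (ω : Draws 6 3 n)
    (t : ℕ) : ℝ :=
  (lowAt v A x₀ ω t).card / (usefulAt A x₀ ω t).card

theorem lowFraction_nonneg (v : K) (ω : Draws 6 3 n) (t : ℕ) : 0 ≤ lowFraction v A x₀ ω t := by
  unfold lowFraction; positivity

theorem lowFraction_le_one (v : K) (ω : Draws 6 3 n) (t : ℕ) : lowFraction v A x₀ ω t ≤ 1 := by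
  refine div_le_one_of_le₀ ?_ (Nat.cast_nonneg _)
  exact_mod_cast Finset.card_le_card (lowAt_subset v ω t)

/-! ### Agreement while a quarter of the servers is useful -/

open Classical in
/-- The potential of the threshold `v` in round `t` if at least a quarter of the servers is useful
in all rounds up to `t`, and `0` otherwise. -/
noncomputable def agreementPotential (v : K) (A : Adversary 6 3 n) (x₀ : Fin n → K) (t : ℕ)
    (ω : Draws 6 3 n) : ℝ :=
  if ∀ s ≤ t, n ≤ 4 * (usefulAt A x₀ ω s).card then potential (160 / n) (lowFraction v A x₀ ω t)
  else 0

theorem agreementPotential_nonneg (v : K) (t : ℕ) (ω : Draws 6 3 n) :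
    0 ≤ agreementPotential v A x₀ t ω := by
  unfold agreementPotential
  split_ifs
  · exact potential_nonneg (by positivity) (lowFraction_nonneg v ω t) (lowFraction_le_one v ω t)
  · exact le_rfl

theorem dependsOn_agreementPotential (v : K) (hA : A.IsLate 1) (t : ℕ) :
    DependsOn (agreementPotential v A x₀ t) (Set.Iio t) := by
  intro ω ω' h
  have h1 : ∀ s ≤ t, usefulAt A x₀ ω s = usefulAt A x₀ ω' s := fun s hs =>
    usefulAt_congr hA fun r hr => h r (Set.mem_Iio.2 (by omega))
  have h2 : (∀ s ≤ t, n ≤ 4 * (usefulAt A x₀ ω s).card) ↔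
      ∀ s ≤ t, n ≤ 4 * (usefulAt A x₀ ω' s).card :=
    forall₂_congr fun s hs => by rw [h1 s hs]
  have h3 : lowAt v A x₀ ω t = lowAt v A x₀ ω' t := lowAt_congr v hA fun r hr => h r hr
  simp only [agreementPotential, h2, lowFraction, h1 t le_rfl, h3]

theorem average_agreementPotential_le [NeZero n] (hn : 640 ≤ n) (v : K) (hA : A.IsLate 1) (t : ℕ)
    (ω : Draws 6 3 n) :
    average (fun ρ => agreementPotential v A x₀ (t + 1) (Function.update ω t ρ))
      ≤ (1 - 1 / 20000) * agreementPotential v A x₀ t ω := by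
  have hΛ : (0 : ℝ) ≤ 160 / n := by positivity
  by_cases hω : ∀ s ≤ t, n ≤ 4 * (usefulAt A x₀ ω s).card
  · let F : ℕ → ℕ → ℝ := fun k j => if n ≤ 4 * k then potential (160 / n) (j / k) else 0
    have hF0 : ∀ k j, j ≤ k → 0 ≤ F k j := by
      intro k j hj
      simp only [F]
      split_ifs
      · exact potential_nonneg hΛ (by positivity)
          (div_le_one_of_le₀ (by exact_mod_cast hj) (Nat.cast_nonneg _))
      · exact le_rfl
    refine (average_mono (G := fun ρ => F (usefulAt A x₀ (Function.update ω t ρ) (t + 1)).card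
          (lowAt v A x₀ (Function.update ω t ρ) (t + 1)).card) fun ρ => ?_).trans ?_
    · rw [agreementPotential]
      split_ifs with h
      · simp only [F, h (t + 1) le_rfl, if_true]
        exact le_rfl
      · exact hF0 _ _ (Finset.card_le_card (lowAt_subset _ _ _))
    · rw [average_round hA, agreementPotential, if_pos hω]
      have h0 := lowFraction_nonneg (A := A) (x₀ := x₀) v ω t
      have h1 := lowFraction_le_one (A := A) (x₀ := x₀) v ω t
      have hpot : 0 ≤ (1 - 1 / 20000) * potential (160 / n) (lowFraction v A x₀ ω t) :=
        mul_nonneg (by norm_num) (potential_nonneg hΛ h0 h1)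
      refine (binomialMean_mono (replyProb_nonneg _) (replyProb_le_one _) _
        (f₂ := fun _ => (1 - 1 / 20000) * potential (160 / n) (lowFraction v A x₀ ω t))
        fun k hk => ?_).trans_eq (binomialMean_const _ _ _)
      by_cases hk4 : n ≤ 4 * k
      · simp only [F, hk4, if_true]
        exact binomialMean_potential_le hn (hk.trans (card_finset_fin_le _)) hk4 h0 h1
      · simp only [F, hk4, if_false, binomialMean_const]
        exact hpot
  · have : (fun ρ => agreementPotential v A x₀ (t + 1) (Function.update ω t ρ)) =
        fun _ => (0 : ℝ) * 0 := by
      ext ρ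
      rw [agreementPotential, if_neg, mul_zero]
      intro h
      refine hω fun s hs => ?_
      rw [← usefulAt_update_of_le hA hs ω ρ]
      exact h s (by omega)
    rw [this, average_mul_const, zero_mul]
    exact mul_nonneg (by norm_num) (agreementPotential_nonneg v t ω)

theorem lintegral_agreementPotential_le [NeZero n] (hn : 640 ≤ n) (v : K) (hA : A.IsLate 1)
    (t : ℕ) :
    ∫⁻ ω, ENNReal.ofReal (agreementPotential v A x₀ t ω) ∂drawMeasure 6 3 n
      ≤ ENNReal.ofReal ((1 - 1 / 20000) ^ t * n) := by
  induction t with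
  | zero =>
    have hn0 : (0 : ℝ) < n := by exact_mod_cast (show 0 < n by omega)
    have h : ∀ ω, agreementPotential v A x₀ 0 ω ≤ n := by
      intro ω
      unfold agreementPotential
      split_ifs
      · rw [potential]
        set q := lowFraction v A x₀ ω 0
        rw [div_le_iff₀ (by positivity)]
        have : (n : ℝ) * (160 / n) = 160 := by field_simp
        nlinarith [sq_nonneg (q - 1 / 2), mul_nonneg hn0.le (sq_nonneg (q - 1 / 2))]
      · exact hn0.le
    calc ∫⁻ ω, ENNReal.ofReal (agreementPotential v A x₀ 0 ω) ∂drawMeasure 6 3 n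
        ≤ ∫⁻ _, ENNReal.ofReal n ∂drawMeasure 6 3 n :=
          lintegral_mono fun ω => ENNReal.ofReal_le_ofReal (h ω)
      _ = ENNReal.ofReal ((1 - 1 / 20000) ^ 0 * n) := by simp
  | succ t ih =>
    refine (lintegral_le_of_average_le (by norm_num) (agreementPotential_nonneg v (t + 1))
      (dependsOn_agreementPotential v hA (t + 1)) (dependsOn_agreementPotential v hA t)
      (average_agreementPotential_le hn v hA t)).trans ?_
    calc ENNReal.ofReal (1 - 1 / 20000) *
          ∫⁻ ω, ENNReal.ofReal (agreementPotential v A x₀ t ω) ∂drawMeasure 6 3 n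
        ≤ ENNReal.ofReal (1 - 1 / 20000) * ENNReal.ofReal ((1 - 1 / 20000) ^ t * n) := by gcongr
      _ = ENNReal.ofReal ((1 - 1 / 20000) ^ (t + 1) * n) := by
        rw [← ENNReal.ofReal_mul (by norm_num)]
        congr 1
        ring

theorem le_potential {n k j : ℕ} (hn : 640 ≤ n) (hk : k ≤ n) (hj : 0 < j) (hjk : j < k) :
    1 / (n : ℝ) ≤ potential (160 / n) (j / k) := by
  have hn0 : (640 : ℝ) ≤ n := by exact_mod_cast hn
  have hkn : (k : ℝ) ≤ n := by exact_mod_cast hk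
  have hj1 : (1 : ℝ) ≤ j := by exact_mod_cast hj
  have hjk1 : (j : ℝ) + 1 ≤ k := by exact_mod_cast hjk
  have hk0 : (0 : ℝ) < k := by linarith
  have h1 : (j / k : ℝ) * (1 - j / k) = j * (k - j) / k ^ 2 := by field_simp
  have h2 : 1 / (2 * n : ℝ) ≤ j * (k - j) / k ^ 2 := by
    have : 1 / (2 * n : ℝ) ≤ 1 / (2 * k) := by gcongr
    refine this.trans ?_
    rw [div_le_div_iff₀ (by positivity) (by positivity)]
    nlinarith [mul_nonneg (sub_nonneg.2 hj1) (show (0 : ℝ) ≤ k - j - 1 by linarith)]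
  have h3 : 160 / (n : ℝ) + (j / k - 1 / 2 : ℝ) ^ 2 ≤ 1 / 2 := by
    have h4 : 160 / (n : ℝ) ≤ 1 / 4 := by rw [div_le_iff₀ (by linarith)]; linarith
    have h5 : (j / k - 1 / 2 : ℝ) ^ 2 = 1 / 4 - (j / k : ℝ) * (1 - j / k) := by ring
    have h6 : 0 ≤ j * ((k : ℝ) - j) / k ^ 2 := le_trans (by positivity) h2
    rw [h5, h1]
    linarith
  rw [potential, le_div_iff₀ (by positivity), h1]
  calc 1 / (n : ℝ) * (160 / n + (j / k - 1 / 2) ^ 2) ≤ 1 / n * (1 / 2) := by gcongr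
    _ = 1 / (2 * n) := by field_simp
    _ ≤ _ := h2

/-- With a quarter of useful servers in every round, a given threshold is unlikely to separate
useful servers after many rounds. -/
theorem measure_not_agree_le [NeZero n] (hn : 640 ≤ n) (v : K) (hA : A.IsLate 1) (t : ℕ) :
    drawMeasure 6 3 n {ω | (∀ s ≤ t, n ≤ 4 * (usefulAt A x₀ ω s).card) ∧
        (lowAt v A x₀ ω t).Nonempty ∧ lowAt v A x₀ ω t ≠ usefulAt A x₀ ω t}
      ≤ ENNReal.ofReal (n ^ 2 * (1 - 1 / 20000) ^ t) := by
  have hn0 : (0 : ℝ) < n := by exact_mod_cast (show 0 < n by omega)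
  have := measure_le_of_lintegral_le (a := 1 / n) (by positivity)
    (dependsOn_agreementPotential v hA t) (lintegral_agreementPotential_le (x₀ := x₀) hn v hA t)
    (s := {ω | (∀ s ≤ t, n ≤ 4 * (usefulAt A x₀ ω s).card) ∧
        (lowAt v A x₀ ω t).Nonempty ∧ lowAt v A x₀ ω t ≠ usefulAt A x₀ ω t}) ?_
  · refine this.trans_eq ?_
    congr 1
    field_simp
  · rintro ω ⟨h1, h2, h3⟩
    rw [agreementPotential, if_pos h1]
    exact le_potential hn (card_finset_fin_le _) (Finset.card_pos.2 h2)
      (Finset.card_lt_card ((lowAt_subset v ω t).ssubset_of_ne h3))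

/-! ### Extinction below a quarter of useful servers -/

open Classical in
/-- The number of useful servers in round `s + t`, if less than a quarter of the servers is useful
in all rounds from `s` to `s + t`, and `0` otherwise. -/
noncomputable def extinctionPotential (A : Adversary 6 3 n) (x₀ : Fin n → K) (s t : ℕ)
    (ω : Draws 6 3 n) : ℝ :=
  if ∀ r ≤ t, 4 * (usefulAt A x₀ ω (s + r)).card < n then ((usefulAt A x₀ ω (s + t)).card : ℝ)
  else 0

theorem extinctionPotential_nonneg (s t : ℕ) (ω : Draws 6 3 n) :
    0 ≤ extinctionPotential A x₀ s t ω := by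
  unfold extinctionPotential
  split_ifs
  · positivity
  · exact le_rfl

theorem dependsOn_extinctionPotential (hA : A.IsLate 1) (s t : ℕ) :
    DependsOn (extinctionPotential A x₀ s t) (Set.Iio (s + t)) := by
  intro ω ω' h
  have h1 : ∀ r ≤ t, usefulAt A x₀ ω (s + r) = usefulAt A x₀ ω' (s + r) := fun r hr =>
    usefulAt_congr hA fun i hi => h i (Set.mem_Iio.2 (by omega))
  have h2 : (∀ r ≤ t, 4 * (usefulAt A x₀ ω (s + r)).card < n) ↔
      ∀ r ≤ t, 4 * (usefulAt A x₀ ω' (s + r)).card < n :=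
    forall₂_congr fun r hr => by rw [h1 r hr]
  simp only [extinctionPotential, h2, h1 t le_rfl]

theorem binomialMean_cast (p : ℝ) (k : ℕ) : binomialMean p k (fun j => (j : ℝ)) = k * p := by
  simpa using binomialMean_id_sub p k 0

theorem average_card_usefulAt [NeZero n] (hA : A.IsLate 1) (ω : Draws 6 3 n) (t : ℕ)
    (F : ℕ → ℝ) :
    average (fun ρ : Fin n → Draw 6 3 n =>
        F (usefulAt A x₀ (Function.update ω t ρ) (t + 1)).card)
      = binomialMean (replyProb (usefulAt A x₀ ω t)) (A t ω ∪ A (t + 1) ω)ᶜ.card F := by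
  have := average_round (x₀ := x₀) hA (x₀ 0) ω t fun k _ => F k
  simpa only [binomialMean_const] using this

theorem average_extinctionPotential_le [NeZero n] (hA : A.IsLate 1) (s t : ℕ)
    (ω : Draws 6 3 n) :
    average (fun ρ => extinctionPotential A x₀ s (t + 1) (Function.update ω (s + t) ρ))
      ≤ 7 / 10 * extinctionPotential A x₀ s t ω := by
  have hn : (0 : ℝ) < n := by exact_mod_cast Nat.pos_of_ne_zero (NeZero.ne n)
  by_cases hω : ∀ r ≤ t, 4 * (usefulAt A x₀ ω (s + r)).card < n
  · refine (average_mono (G := fun ρ =>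
      ((usefulAt A x₀ (Function.update ω (s + t) ρ) (s + t + 1)).card : ℝ)) fun ρ => ?_).trans ?_
    · rw [extinctionPotential]
      split_ifs
      · exact le_rfl
      · positivity
    · rw [average_card_usefulAt hA ω (s + t) fun k => (k : ℝ), binomialMean_cast,
        extinctionPotential, if_pos hω]
      have h1 : ((A (s + t) ω ∪ A (s + t + 1) ω)ᶜ.card : ℝ) ≤ n := by
        exact_mod_cast card_finset_fin_le _
      have h2 := replyProb_le (hω t le_rfl).le
      have h3 := replyProb_nonneg (usefulAt A x₀ ω (s + t))
      calc ((A (s + t) ω ∪ A (s + t + 1) ω)ᶜ.card : ℝ) * replyProb (usefulAt A x₀ ω (s + t))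
          ≤ n * (7 / 10 * ((usefulAt A x₀ ω (s + t)).card / n)) := by gcongr
        _ = 7 / 10 * (usefulAt A x₀ ω (s + t)).card := by field_simp
  · have : (fun ρ => extinctionPotential A x₀ s (t + 1) (Function.update ω (s + t) ρ)) =
        fun _ => (0 : ℝ) * 0 := by
      ext ρ
      rw [extinctionPotential, if_neg, mul_zero]
      intro h
      refine hω fun r hr => ?_
      rw [← usefulAt_update_of_le hA (Nat.add_le_add_left hr s) ω ρ]
      exact h r (by omega)
    rw [this, average_mul_const, zero_mul]
    exact mul_nonneg (by norm_num) (extinctionPotential_nonneg s t ω)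

theorem lintegral_extinctionPotential_le [NeZero n] (hA : A.IsLate 1) (s t : ℕ) :
    ∫⁻ ω, ENNReal.ofReal (extinctionPotential A x₀ s t ω) ∂drawMeasure 6 3 n
      ≤ ENNReal.ofReal ((7 / 10) ^ t * n) := by
  induction t with
  | zero =>
    have h : ∀ ω, extinctionPotential A x₀ s 0 ω ≤ n := by
      intro ω
      unfold extinctionPotential
      split_ifs
      · exact_mod_cast card_finset_fin_le _
      · positivity
    calc ∫⁻ ω, ENNReal.ofReal (extinctionPotential A x₀ s 0 ω) ∂drawMeasure 6 3 n
        ≤ ∫⁻ _, ENNReal.ofReal n ∂drawMeasure 6 3 n :=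
          lintegral_mono fun ω => ENNReal.ofReal_le_ofReal (h ω)
      _ = ENNReal.ofReal ((7 / 10) ^ 0 * n) := by simp
  | succ t ih =>
    refine (lintegral_le_of_average_le (by norm_num) (extinctionPotential_nonneg s (t + 1))
      (dependsOn_extinctionPotential hA s (t + 1)) (dependsOn_extinctionPotential hA s t)
      (average_extinctionPotential_le hA s t)).trans ?_
    calc ENNReal.ofReal (7 / 10) *
          ∫⁻ ω, ENNReal.ofReal (extinctionPotential A x₀ s t ω) ∂drawMeasure 6 3 n
        ≤ ENNReal.ofReal (7 / 10) * ENNReal.ofReal ((7 / 10) ^ t * n) := by gcongr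
      _ = ENNReal.ofReal ((7 / 10) ^ (t + 1) * n) := by
        rw [← ENNReal.ofReal_mul (by norm_num)]
        congr 1
        ring

/-- With less than a quarter of useful servers in every round, a useful server is unlikely to
exist after many rounds. -/
theorem measure_not_extinct_le [NeZero n] (hA : A.IsLate 1) (s t : ℕ) :
    drawMeasure 6 3 n {ω | (∀ r ≤ t, 4 * (usefulAt A x₀ ω (s + r)).card < n) ∧
        (usefulAt A x₀ ω (s + t)).Nonempty}
      ≤ ENNReal.ofReal (n * (7 / 10) ^ t) := by
  have := measure_le_of_lintegral_le one_pos
    (dependsOn_extinctionPotential hA s t) (lintegral_extinctionPotential_le (x₀ := x₀) hA s t)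
    (s := {ω | (∀ r ≤ t, 4 * (usefulAt A x₀ ω (s + r)).card < n) ∧
        (usefulAt A x₀ ω (s + t)).Nonempty}) ?_
  · refine this.trans_eq ?_
    congr 1
    ring
  · rintro ω ⟨h1, h2⟩
    rw [extinctionPotential, if_pos h1]
    exact_mod_cast Finset.card_pos.2 h2

open Classical in
/-- The indicator of the event that the useful servers become a quarter of all servers again in
round `t + 1`. -/
noncomputable def recovery (A : Adversary 6 3 n) (x₀ : Fin n → K) (t : ℕ)
    (ω : Draws 6 3 n) : ℝ :=
  if 4 * (usefulAt A x₀ ω t).card < n ∧ n ≤ 4 * (usefulAt A x₀ ω (t + 1)).card then 1 else 0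

theorem average_recovery_le [NeZero n] (hA : A.IsLate 1) (t : ℕ) (ω : Draws 6 3 n) :
    average (fun ρ => recovery A x₀ t (Function.update ω t ρ)) ≤ (87 / 88) ^ n * 1 := by
  have hn : (0 : ℝ) < n := by exact_mod_cast Nat.pos_of_ne_zero (NeZero.ne n)
  by_cases hω : 4 * (usefulAt A x₀ ω t).card < n
  · -- the exponential moment for the base `3 / 2`, which exceeds `(11 / 10) ^ 4`
    refine (average_mono (G := fun ρ => ((10 : ℝ) / 11) ^ n *
      (3 / 2) ^ (usefulAt A x₀ (Function.update ω t ρ) (t + 1)).card) fun ρ => ?_).trans ?_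
    · rw [recovery]
      split_ifs with h
      · set k := (usefulAt A x₀ (Function.update ω t ρ) (t + 1)).card
        calc (1 : ℝ) = (10 / 11) ^ n * (11 / 10) ^ n := by rw [← mul_pow]; norm_num
          _ ≤ (10 / 11) ^ n * (11 / 10) ^ (4 * k) := by
            gcongr
            · norm_num
            · exact h.2
          _ = (10 / 11) ^ n * ((11 / 10) ^ 4) ^ k := by rw [pow_mul]
          _ ≤ (10 / 11) ^ n * (3 / 2) ^ k := by gcongr; norm_num
      · positivity
    · rw [average_mul_const, average_card_usefulAt hA ω t fun k => (3 / 2 : ℝ) ^ k,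
        binomialMean_pow, mul_one]
      have h2 := replyProb_le hω.le
      have h3 := replyProb_nonneg (usefulAt A x₀ ω t)
      have h4 : ((usefulAt A x₀ ω t).card : ℝ) / n ≤ 1 / 4 := by
        rw [div_le_iff₀ hn]
        have : (4 * (usefulAt A x₀ ω t).card : ℝ) < n := by exact_mod_cast hω
        linarith
      set p := replyProb (usefulAt A x₀ ω t)
      calc ((10 : ℝ) / 11) ^ n * (1 - p + p * (3 / 2)) ^ (A t ω ∪ A (t + 1) ω)ᶜ.card
          ≤ (10 / 11) ^ n * (1 - p + p * (3 / 2)) ^ n := by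
            gcongr
            · linarith
            · exact card_finset_fin_le _
        _ ≤ (10 / 11) ^ n * (87 / 80) ^ n := by
            gcongr
            · linarith
            · linarith
        _ = (87 / 88) ^ n := by rw [← mul_pow]; norm_num
  · have : (fun ρ => recovery A x₀ t (Function.update ω t ρ)) = fun _ => (0 : ℝ) * 0 := by
      ext ρ
      rw [recovery, if_neg, mul_zero]
      rintro ⟨h, -⟩
      exact hω (usefulAt_update_of_le (x₀ := x₀) hA le_rfl ω ρ ▸ h)
    rw [this, average_mul_const, zero_mul]
    positivity

/-- The number of useful servers is unlikely to return to a quarter of all servers. -/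
theorem measure_recovery_le [NeZero n] (hA : A.IsLate 1) (t : ℕ) :
    drawMeasure 6 3 n {ω | 4 * (usefulAt A x₀ ω t).card < n ∧
        n ≤ 4 * (usefulAt A x₀ ω (t + 1)).card}
      ≤ ENNReal.ofReal ((87 / 88) ^ n) := by
  have hdep : DependsOn (recovery A x₀ t) (Set.Iio (t + 1)) := by
    intro ω ω' h
    have h1 : usefulAt A x₀ ω t = usefulAt A x₀ ω' t :=
      usefulAt_congr hA fun r hr => h r (Set.mem_Iio.2 (by omega))
    have h2 : usefulAt A x₀ ω (t + 1) = usefulAt A x₀ ω' (t + 1) :=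
      usefulAt_congr hA fun r hr => h r hr
    simp only [recovery, h1, h2]
  have h0 : ∀ ω, 0 ≤ recovery A x₀ t ω := by
    intro ω
    unfold recovery
    split_ifs <;> norm_num
  have h := lintegral_le_of_average_le (f := fun _ => 1) (by positivity) h0 hdep
    (fun _ _ _ => rfl) (average_recovery_le hA t)
  have := measure_le_of_lintegral_le one_pos hdep (b := (87 / 88) ^ n) (h.trans_eq (by simp))
    (s := {ω | 4 * (usefulAt A x₀ ω t).card < n ∧
        n ≤ 4 * (usefulAt A x₀ ω (t + 1)).card}) fun ω ⟨h1, h2⟩ => by rw [recovery, if_pos ⟨h1, h2⟩]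
  simpa using this

end Rounds

/-! ### Values along the process -/

section Outcome

variable {n : ℕ} {K : Type u} [LinearOrder K] {x₀ : Fin n → K} {A : Adversary 6 3 n}
  {ω : Draws 6 3 n}

theorem exists_mem_usefulAt_of_config {t : ℕ} {i : Fin n} {m : K}
    (h : config A x₀ ω (t + 1) i = some m) :
    ∃ j ∈ usefulAt A x₀ ω t, config A x₀ ω t j = some m :=
  exists_mem_useful_of_step h

theorem isSome_of_mem_usefulAt {t : ℕ} {i : Fin n} (hi : i ∈ usefulAt A x₀ ω t) :
    ∃ m, config A x₀ ω t i = some m :=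
  Option.isSome_iff_exists.1 (Finset.mem_filter.1 hi).2.2

/-- Medians of three values never create new values. -/
theorem exists_initial_of_config (t : ℕ) {i : Fin n} {m : K} (h : config A x₀ ω t i = some m) :
    ∃ j, x₀ j = m := by
  induction t generalizing i with
  | zero => exact ⟨i, Option.some_injective _ h⟩
  | succ t ih =>
    obtain ⟨j, -, hj⟩ := exists_mem_usefulAt_of_config h
    exact ih hj

theorem config_eq_none_of_usefulAt_eq_empty {s t : ℕ} (hs : usefulAt A x₀ ω s = ∅) (hst : s < t)
    (i : Fin n) : config A x₀ ω t i = none := by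
  have key : ∀ d, usefulAt A x₀ ω (s + d) = ∅ := by
    intro d
    induction d with
    | zero => exact hs
    | succ d ih =>
      refine Finset.eq_empty_of_forall_notMem fun i hi => ?_
      obtain ⟨m, hm⟩ := isSome_of_mem_usefulAt hi
      obtain ⟨j, hj, -⟩ := exists_mem_usefulAt_of_config (t := s + d) hm
      rw [ih] at hj
      simp at hj
  obtain ⟨d, rfl⟩ := Nat.exists_eq_add_of_lt hst
  rw [Option.eq_none_iff_forall_ne_some]
  intro m hm
  obtain ⟨j, hj, -⟩ := exists_mem_usefulAt_of_config hm
  rw [key d] at hj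
  simp at hj

/-- Agreement persists, since every value adopted later is held by a useful server before. -/
theorem agreementAfter_of_forall {s T : ℕ} {v : K} (hsT : s ≤ T)
    (h : ∀ i ∈ usefulAt A x₀ ω s, config A x₀ ω s i = some v) : AgreementAfter A x₀ ω T := by
  have key : ∀ d, ∀ i ∈ usefulAt A x₀ ω (s + d), config A x₀ ω (s + d) i = some v := by
    intro d
    induction d with
    | zero => exact h
    | succ d ih =>
      intro i hi
      obtain ⟨m, hm⟩ := isSome_of_mem_usefulAt hi
      obtain ⟨j, hj, hjm⟩ := exists_mem_usefulAt_of_config (t := s + d) hm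
      rw [ih j hj] at hjm
      exact hm.trans hjm.symm
  refine ⟨v, fun t ht => ?_⟩
  obtain ⟨d, rfl⟩ := Nat.exists_eq_add_of_le (hsT.trans ht)
  exact key d

/-- If no initial value separates useful servers as a threshold, then they agree: every value in use
is an initial value, so each of them is at most every other one. -/
theorem exists_agreement_of_thresholds {t : ℕ} (hne : (usefulAt A x₀ ω t).Nonempty)
    (h : ∀ j, (lowAt (x₀ j) A x₀ ω t).Nonempty →
      lowAt (x₀ j) A x₀ ω t = usefulAt A x₀ ω t) :
    ∃ v, ∀ i ∈ usefulAt A x₀ ω t, config A x₀ ω t i = some v := by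
  have key : ∀ i ∈ usefulAt A x₀ ω t, ∀ a, config A x₀ ω t i = some a →
      ∀ i' ∈ usefulAt A x₀ ω t, ∀ b, config A x₀ ω t i' = some b → b ≤ a := by
    intro i hi a ha i' hi' b hb
    obtain ⟨j, rfl⟩ := exists_initial_of_config t ha
    rw [← h j ⟨i, Finset.mem_filter.2 ⟨hi, _, ha, le_rfl⟩⟩] at hi'
    obtain ⟨b', hb', hle⟩ := (Finset.mem_filter.1 hi').2
    rw [hb] at hb'
    cases hb'
    exact hle
  obtain ⟨i, hi⟩ := hne
  obtain ⟨a, ha⟩ := isSome_of_mem_usefulAt hi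
  refine ⟨a, fun i' hi' => ?_⟩
  obtain ⟨b, hb⟩ := isSome_of_mem_usefulAt hi'
  rw [hb, le_antisymm (key i hi a ha i' hi' b hb) (key i' hi' b hb i hi a ha)]

/-! ### The union bound -/

/-- The deterministic part of the argument: the claim holds unless one of the unlikely events
occurs. The first `T / 2` rounds serve for agreement, or else the servers die out in the next
`T / 2` rounds; a drop below a quarter in any of the first `T` rounds leads to extinction by round
`T + T / 2`. -/
theorem outcome_of_typical [NeZero n] {T : ℕ}
    (hagree : ∀ j, (∀ s ≤ T / 2, n ≤ 4 * (usefulAt A x₀ ω s).card) →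
      (lowAt (x₀ j) A x₀ ω (T / 2)).Nonempty →
        lowAt (x₀ j) A x₀ ω (T / 2) = usefulAt A x₀ ω (T / 2))
    (hext₁ : (∀ r ≤ T / 2, 4 * (usefulAt A x₀ ω (T / 2 + r)).card < n) →
      usefulAt A x₀ ω (T / 2 + T / 2) = ∅)
    (hext₂ : (∀ r ≤ T / 2, 4 * (usefulAt A x₀ ω (T + r)).card < n) →
      usefulAt A x₀ ω (T + T / 2) = ∅)
    (hrec : ∀ t < 2 * T, 4 * (usefulAt A x₀ ω t).card < n →
      4 * (usefulAt A x₀ ω (t + 1)).card < n) :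
    AgreementAfter A x₀ ω T ∧ (QuarterUseful A x₀ ω T ∨ AllUndecidedAfter A x₀ ω (2 * T)) := by
  have hn : 0 < n := Nat.pos_of_ne_zero (NeZero.ne n)
  have hstay : ∀ s, 4 * (usefulAt A x₀ ω s).card < n → ∀ t, s ≤ t → t ≤ 2 * T →
      4 * (usefulAt A x₀ ω t).card < n := by
    intro s hs t hst
    induction t, hst using Nat.le_induction with
    | base => exact fun _ => hs
    | succ t _ ih => exact fun ht => hrec t (by omega) (ih (by omega))
  have hundec : ∀ s < T, 4 * (usefulAt A x₀ ω s).card < n →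
      AllUndecidedAfter A x₀ ω (2 * T) := by
    intro s hs h t ht i
    refine config_eq_none_of_usefulAt_eq_empty (hext₂ fun r hr => ?_) (by omega) i
    exact hstay s h _ (by omega) (by omega)
  constructor
  · by_cases hq : ∀ s ≤ T / 2, n ≤ 4 * (usefulAt A x₀ ω s).card
    · have hne : (usefulAt A x₀ ω (T / 2)).Nonempty := by
        rw [← Finset.card_pos]
        have := hq (T / 2) le_rfl
        omega
      obtain ⟨v, hv⟩ := exists_agreement_of_thresholds hne fun j => hagree j hq
      exact agreementAfter_of_forall (Nat.div_le_self T 2) hv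
    · push Not at hq
      obtain ⟨s, hs, h⟩ := hq
      have he := hext₁ fun r hr => hstay s h _ (by omega) (by omega)
      exact agreementAfter_of_forall (s := T / 2 + T / 2) (v := x₀ 0) (by omega) fun i hi => by
        rw [he] at hi
        simp at hi
  · by_cases hq : ∀ s < T, n ≤ 4 * (usefulAt A x₀ ω s).card
    · left
      intro t ht
      have : (n : ℝ) ≤ 4 * (usefulAt A x₀ ω t).card := by exact_mod_cast hq t ht
      linarith
    · push Not at hq
      obtain ⟨s, hs, h⟩ := hq
      exact Or.inr (hundec s hs h)

/-- The union bound over the unlikely events. -/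
theorem measure_not_outcome_le [NeZero n] (hn : 640 ≤ n) (x₀ : Fin n → K) (hA : A.IsLate 1)
    (T : ℕ) :
    drawMeasure 6 3 n {ω | ¬ (AgreementAfter A x₀ ω T ∧
        (QuarterUseful A x₀ ω T ∨ AllUndecidedAfter A x₀ ω (2 * T)))}
      ≤ ENNReal.ofReal (3 * n ^ 3 * (1 - 1 / 20000) ^ (T / 2) + 2 * T * (87 / 88) ^ n) := by
  -- `E₁ j`: the threshold `x₀ j` still separates; `E₂ s`: no extinction from round `s` on;
  -- `E₃ t`: a recovery from below a quarter
  let E₁ : Fin n → Set (Draws 6 3 n) := fun j =>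
    {ω | (∀ s ≤ T / 2, n ≤ 4 * (usefulAt A x₀ ω s).card) ∧
      (lowAt (x₀ j) A x₀ ω (T / 2)).Nonempty ∧
        lowAt (x₀ j) A x₀ ω (T / 2) ≠ usefulAt A x₀ ω (T / 2)}
  let E₂ : ℕ → Set (Draws 6 3 n) := fun s =>
    {ω | (∀ r ≤ T / 2, 4 * (usefulAt A x₀ ω (s + r)).card < n) ∧
      (usefulAt A x₀ ω (s + T / 2)).Nonempty}
  let E₃ : ℕ → Set (Draws 6 3 n) := fun t =>
    {ω | 4 * (usefulAt A x₀ ω t).card < n ∧ n ≤ 4 * (usefulAt A x₀ ω (t + 1)).card}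
  have hsub : {ω | ¬ (AgreementAfter A x₀ ω T ∧
        (QuarterUseful A x₀ ω T ∨ AllUndecidedAfter A x₀ ω (2 * T)))}
      ⊆ ((⋃ j ∈ Finset.univ, E₁ j) ∪ (E₂ (T / 2) ∪ E₂ T)) ∪ ⋃ t ∈ Finset.range (2 * T), E₃ t := by
    intro ω hω
    by_contra hcon
    simp only [Set.mem_union, Set.mem_iUnion, Finset.mem_univ, exists_prop, true_and,
      Finset.mem_range, not_or, not_exists, not_and] at hcon
    obtain ⟨⟨h1, h2, h3⟩, h4⟩ := hcon
    refine hω (outcome_of_typical ?_ ?_ ?_ ?_)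
    · intro j hs hne
      by_contra h
      exact h1 j ⟨hs, hne, h⟩
    · intro hr
      by_contra h
      exact h2 ⟨hr, Finset.nonempty_iff_ne_empty.2 h⟩
    · intro hr
      by_contra h
      exact h3 ⟨hr, Finset.nonempty_iff_ne_empty.2 h⟩
    · intro t ht h
      by_contra h'
      exact h4 t ht ⟨h, not_lt.1 h'⟩
  have hn0 : (1 : ℝ) ≤ n := by exact_mod_cast (show 1 ≤ n by omega)
  have b1 : drawMeasure 6 3 n (⋃ j ∈ Finset.univ, E₁ j)
      ≤ ENNReal.ofReal (n * (n ^ 2 * (1 - 1 / 20000) ^ (T / 2))) := by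
    refine (measure_biUnion_finset_le _ _).trans ?_
    refine (Finset.sum_le_sum fun j _ => measure_not_agree_le hn (x₀ j) hA (T / 2)).trans ?_
    rw [Finset.sum_const, Finset.card_univ, Fintype.card_fin, nsmul_eq_mul,
      ENNReal.ofReal_mul (Nat.cast_nonneg n), ENNReal.ofReal_natCast]
  have b2 : ∀ s, drawMeasure 6 3 n (E₂ s)
      ≤ ENNReal.ofReal (n * (1 - 1 / 20000) ^ (T / 2)) := by
    intro s
    refine (measure_not_extinct_le hA s (T / 2)).trans (ENNReal.ofReal_le_ofReal ?_)
    gcongr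
    norm_num
  have b3 : drawMeasure 6 3 n (⋃ t ∈ Finset.range (2 * T), E₃ t)
      ≤ ENNReal.ofReal ((2 * T : ℕ) * (87 / 88) ^ n) := by
    refine (measure_biUnion_finset_le _ _).trans ?_
    refine (Finset.sum_le_sum fun t _ => measure_recovery_le hA t).trans ?_
    rw [Finset.sum_const, Finset.card_range, nsmul_eq_mul,
      ENNReal.ofReal_mul (Nat.cast_nonneg _), ENNReal.ofReal_natCast]
  have hε : (0 : ℝ) ≤ (1 - 1 / 20000) ^ (T / 2) := by norm_num
  refine (measure_mono hsub).trans ((measure_union_le _ _).trans ?_)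
  refine (add_le_add ((measure_union_le _ _).trans (add_le_add b1
    ((measure_union_le _ _).trans (add_le_add (b2 _) (b2 _))))) b3).trans ?_
  rw [← ENNReal.ofReal_add (by positivity) (by positivity),
    ← ENNReal.ofReal_add (by positivity) (by positivity),
    ← ENNReal.ofReal_add (by positivity) (by positivity)]
  refine ENNReal.ofReal_le_ofReal ?_
  have h3 : (n : ℝ) ≤ n ^ 3 := le_self_pow₀ hn0 (by norm_num)
  have h4 := mul_le_mul_of_nonneg_right h3 hε
  push_cast
  nlinarith

end Outcome

/-! ### Logarithmically many rounds suffice -/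

/-- For a sufficiently large constant, logarithmically many rounds make the bound of the union
bound smaller than a given power of `n`. -/
theorem exists_failure_bound_le (c : ℝ) (hc : 0 < c) :
    ∃ n₀ : ℕ, ∀ n : ℕ, n₀ ≤ n → ∀ T : ℕ, T = ⌈40000 * (c + 4) * Real.log n⌉₊ →
      3 * (n : ℝ) ^ 3 * (1 - 1 / 20000) ^ (T / 2) + 2 * T * (87 / 88) ^ n ≤ (n : ℝ) ^ (-c) := by
  set C := 40000 * (c + 4) with hC
  have hC0 : 0 < C := by positivity
  have hlim := (tendsto_pow_const_mul_const_pow_of_abs_lt_one (⌈c⌉₊ + 1)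
    (show |(87 / 88 : ℝ)| < 1 by rw [abs_of_pos] <;> norm_num)).const_mul (2 * (C + 1))
  rw [mul_zero] at hlim
  obtain ⟨n₁, hn₁⟩ := Filter.eventually_atTop.1
    (hlim.eventually (ge_mem_nhds (show (0 : ℝ) < 1 / 2 by norm_num)))
  refine ⟨max n₁ 12, fun n hn T hT => ?_⟩
  have hn12 : (12 : ℝ) ≤ n := by exact_mod_cast (le_max_right _ _).trans hn
  have hn0 : (0 : ℝ) < n := by linarith
  have hlog : 0 ≤ Real.log n := Real.log_nonneg (by linarith)
  have hTlow : C * Real.log n ≤ T := hT ▸ Nat.le_ceil _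
  have hThigh : (T : ℝ) ≤ C * Real.log n + 1 := by
    rw [hT]; exact (Nat.ceil_lt_add_one (by positivity)).le
  have hpow : (0 : ℝ) < (n : ℝ) ^ (-c) := Real.rpow_pos_of_pos hn0 _
  have h1 : (1 - 1 / 20000 : ℝ) ^ (T / 2) ≤ 2 * ((n : ℝ) ^ (-c) / n ^ 4) := by
    have hhalf : (T : ℝ) / 2 - 1 / 2 ≤ ((T / 2 : ℕ) : ℝ) := by
      have : T ≤ 2 * (T / 2) + 1 := by omega
      have : (T : ℝ) ≤ 2 * ((T / 2 : ℕ) : ℝ) + 1 := by exact_mod_cast this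
      linarith
    calc (1 - 1 / 20000 : ℝ) ^ (T / 2) ≤ (Real.exp (-(1 / 20000))) ^ (T / 2) := by
          have : (1 - 1 / 20000 : ℝ) ≤ Real.exp (-(1 / 20000)) := by
            linarith [Real.add_one_le_exp (-(1 / 20000) : ℝ)]
          gcongr
      _ = Real.exp (-(1 / 20000) * (T / 2 : ℕ)) := by rw [← Real.exp_nat_mul]; ring_nf
      _ ≤ Real.exp (1 / 2 + Real.log n * (-c + -4)) := by
          refine Real.exp_le_exp.2 ?_
          have : C * Real.log n = 40000 * (c + 4) * Real.log n := by rw [hC]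
          nlinarith
      _ = Real.exp (1 / 2) * ((n : ℝ) ^ (-c) / n ^ 4) := by
          have e4 : (n : ℝ) ^ (-4 : ℝ) = ((n : ℝ) ^ 4)⁻¹ := by
            rw [Real.rpow_neg hn0.le]
            norm_cast
          rw [Real.exp_add, ← Real.rpow_def_of_pos hn0, Real.rpow_add hn0, e4,
            div_eq_mul_inv ((n : ℝ) ^ (-c))]
      _ ≤ 2 * ((n : ℝ) ^ (-c) / n ^ 4) := by
          gcongr
          have h2 : Real.exp (1 / 2) ^ 2 ≤ 2 ^ 2 := by
            rw [← Real.exp_nat_mul]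
            norm_num
            linarith [Real.exp_one_lt_d9]
          exact (pow_le_pow_iff_left₀ (Real.exp_pos _).le (by norm_num) two_ne_zero).1 h2
  have h2 : 3 * (n : ℝ) ^ 3 * (1 - 1 / 20000) ^ (T / 2) ≤ 1 / 2 * (n : ℝ) ^ (-c) := by
    calc 3 * (n : ℝ) ^ 3 * (1 - 1 / 20000) ^ (T / 2)
        ≤ 3 * (n : ℝ) ^ 3 * (2 * ((n : ℝ) ^ (-c) / n ^ 4)) := by gcongr
      _ = 6 / n * (n : ℝ) ^ (-c) := by field_simp; norm_num
      _ ≤ 1 / 2 * (n : ℝ) ^ (-c) := by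
          have : 6 / (n : ℝ) ≤ 1 / 2 := by
            rw [div_le_iff₀ hn0]
            linarith
          gcongr
  have h3 : 2 * T * (87 / 88 : ℝ) ^ n ≤ 1 / 2 * (n : ℝ) ^ (-c) := by
    have hT' : (T : ℝ) ≤ (C + 1) * n := by
      have := Real.log_le_self hn0.le
      nlinarith
    have hc' : (n : ℝ) ^ c ≤ (n : ℝ) ^ ⌈c⌉₊ := by
      rw [← Real.rpow_natCast]
      exact Real.rpow_le_rpow_of_exponent_le (by linarith) (Nat.le_ceil c)
    have hinv : (n : ℝ) ^ c * (n : ℝ) ^ (-c) = 1 := by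
      rw [← Real.rpow_add hn0]; simp
    calc 2 * T * (87 / 88 : ℝ) ^ n
        = 2 * T * (87 / 88 : ℝ) ^ n * ((n : ℝ) ^ c * (n : ℝ) ^ (-c)) := by rw [hinv, mul_one]
      _ ≤ 2 * ((C + 1) * n) * (87 / 88 : ℝ) ^ n * ((n : ℝ) ^ ⌈c⌉₊ * (n : ℝ) ^ (-c)) := by gcongr
      _ = 2 * (C + 1) * ((n : ℝ) ^ (⌈c⌉₊ + 1) * (87 / 88 : ℝ) ^ n) * (n : ℝ) ^ (-c) := by ring
      _ ≤ 1 / 2 * (n : ℝ) ^ (-c) := by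
          gcongr
          exact hn₁ n ((le_max_left _ _).trans hn)
  linarith

end MedianRule

theorem mainTheorem6 (c : ℝ) (hc : 0 < c) :
    ∃ (C : ℝ) (n₀ : ℕ), 0 < C ∧
      ∀ (n : ℕ) [NeZero n], n₀ ≤ n →
        ∀ (K : Type u) [LinearOrder K] (x₀ : Fin n → K) (A : MedianRule.Adversary 6 3 n),
          A.IsLate 1 →
            MedianRule.drawMeasure 6 3 n
              {ω | ¬ (MedianRule.AgreementAfter A x₀ ω ⌈C * Real.log n⌉₊ ∧
                (MedianRule.QuarterUseful A x₀ ω ⌈C * Real.log n⌉₊ ∨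
                  MedianRule.AllUndecidedAfter A x₀ ω (2 * ⌈C * Real.log n⌉₊)))}
              ≤ ENNReal.ofReal ((n : ℝ) ^ (-c)) := by
  obtain ⟨n₀, hn₀⟩ := MedianRule.exists_failure_bound_le c hc
  refine ⟨40000 * (c + 4), max n₀ 640, by positivity, ?_⟩
  intro n _ hn K _ x₀ A hA
  have hn640 : 640 ≤ n := (le_max_right _ _).trans hn
  exact (MedianRule.measure_not_outcome_le hn640 x₀ hA _).trans
    (ENNReal.ofReal_le_ofReal (hn₀ n ((le_max_left _ _).trans hn) _ rfl))
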